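/- Let $N\ge 1$ be an integer and let $0<\gamma_2<\gamma_1<\min\{N,2\}$ (the mass-subcritical case). For $u\in H^1(\mathbb{R}^N)=H^1(\mathbb{R}^N;\mathbb{C})$ put $$E(u):=\frac12\int_{\mathbb{R}^N}|\nabla u|^2\,dx+\frac14\int_{\mathbb{R}^N}\int_{\mathbb{R}^N}\frac{|u(x)|^2|u(y)|^2}{|x-y|^{\gamma_2}}\,dx\,dy-\frac14\int_{\mathbb{R}^N}\int_{\mathbb{R}^N}\frac{|u(x)|^2|u(y)|^2}{|x-y|^{\gamma_1}}\,dx\,dy,$$ and for $c\ge 0$ let $$S(c):=\Big\{u\in H^1(\mathbb{R}^N):\int_{\mathbb{R}^N}|u|^2\,dx=c\Big\},\qquad m(c):=\inf_{u\in S(c)}E(u).$$ Then the following assertions hold. (i) $-\infty<m(c)\le 0$ for every $c\ge 0$. (ii) The function $c\mapsto m(c)$ is continuous on $(0,\infty)$. (iii) $m(c_1+c_2)\le m(c_1)+m(c_2)$ for all $c_1,c_2\ge 0$ with $c_1+c_2>0$. In addition, $c\mapsto m(c)$ is nonincreasing on $(0,\infty)$. (iv) $\lim_{c\to 0^+}m(c)=0$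 and $\lim_{c\to\infty}m(c)=-\infty$. -/

import Mathlib

open MeasureTheory Filter Topology
open scoped ENNReal ContDiff

noncomputable section

namespace Hartree

/-- Euclidean space `ℝ^N` (with Euclidean norm and Lebesgue measure). -/
abbrev Space (N : ℕ) : Type := EuclideanSpace ℝ (Fin N)

/-- `g` is the weak partial derivative of `u` in the `i`-th coordinate direction on `ℝ^N`:
both are locally integrable and `∫ u ∂ᵢφ = - ∫ g φ` for all test functions `φ ∈ C_c^∞(ℝ^N)`. -/
def IsWeakPartial {N : ℕ} (i : Fin N) (u g : Space N → ℂ) : Prop :=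
  LocallyIntegrable u volume ∧ LocallyIntegrable g volume ∧
    ∀ φ : Space N → ℝ, ContDiff ℝ ∞ φ → HasCompactSupport φ →
      ∫ x, (fderiv ℝ φ x (EuclideanSpace.single i 1)) • u x = - ∫ x, φ x • g x

/-- Weak partial derivatives are unique up to null sets. -/
theorem IsWeakPartial.ae_eq {N : ℕ} {i : Fin N} {u g h : Space N → ℂ}
    (hg : IsWeakPartial i u g) (hh : IsWeakPartial i u h) : g =ᵐ[volume] h := by
  refine ae_eq_of_integral_contDiff_smul_eq hg.2.1 hh.2.1 fun φ hφ hs => ?_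
  have h1 := hg.2.2 φ hφ hs
  rw [hh.2.2 φ hφ hs] at h1
  exact (neg_injective h1).symm

/-- `u` belongs to `H¹(ℝ^N) = H¹(ℝ^N; ℂ)`: `u` is in `L²` and has weak partial derivatives
in `L²` in all coordinate directions. -/
def MemH1 {N : ℕ} (u : Space N → ℂ) : Prop :=
  MemLp u 2 volume ∧ ∀ i : Fin N, ∃ g : Space N → ℂ, MemLp g 2 volume ∧ IsWeakPartial i u g

open Classical in
/-- A representative of the `i`-th weak partial derivative of `u` (zero if there is none);
by uniqueness, its choice does not matter. -/
def weakPartial {N : ℕ} (i : Fin N) (u : Space N → ℂ) : Space N → ℂ :=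
  if h : ∃ g : Space N → ℂ, IsWeakPartial i u g then h.choose else 0

/-- The chosen representative is a weak partial derivative whenever there is one. -/
theorem IsWeakPartial.weakPartial {N : ℕ} {i : Fin N} {u g : Space N → ℂ}
    (hg : IsWeakPartial i u g) : IsWeakPartial i u (weakPartial i u) := by
  have h : ∃ g : Space N → ℂ, IsWeakPartial i u g := ⟨g, hg⟩
  rw [Hartree.weakPartial, dif_pos h]
  exact h.choose_spec

/-- The Dirichlet integral `∫ |∇u|² dx`, with values in `[0, ∞]`. -/
def gradSq {N : ℕ} (u : Space N → ℂ) : ℝ≥0∞ :=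
  ∑ i : Fin N, ∫⁻ x, ‖weakPartial i u x‖ₑ ^ 2

/-- The Hartree term `∫∫ |u(x)|² |u(y)|² / |x - y|^γ dx dy`, with values in `[0, ∞]`. -/
def hartree {N : ℕ} (γ : ℝ) (u : Space N → ℂ) : ℝ≥0∞ :=
  ∫⁻ x, ∫⁻ y, ‖u x‖ₑ ^ 2 * ‖u y‖ₑ ^ 2 / ‖x - y‖ₑ ^ γ

/-- The energy
`E(u) = ½ ∫ |∇u|² + ¼ ∫∫ |u(x)|²|u(y)|²/|x-y|^γ₂ - ¼ ∫∫ |u(x)|²|u(y)|²/|x-y|^γ₁`.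
It is extended-real-valued (with the convention `∞ - ∞ = -∞`), so that no integral has
a default value. -/
def energy {N : ℕ} (γ₁ γ₂ : ℝ) (u : Space N → ℂ) : EReal :=
  ((gradSq u / 2 + hartree γ₂ u / 4 : ℝ≥0∞) : EReal) - ((hartree γ₁ u / 4 : ℝ≥0∞) : EReal)

/-- The constraint set `S(c) = {u ∈ H¹(ℝ^N) : ∫ |u|² dx = c}`. -/
def massSphere (N : ℕ) (c : ℝ) : Set (Space N → ℂ) :=
  {u | MemH1 u ∧ ∫ x, ‖u x‖ ^ 2 = c}

/-- The ground state energy `m(c) = inf {E(u) : u ∈ S(c)}`, as an extended real number. -/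
def groundEnergy (N : ℕ) (γ₁ γ₂ : ℝ) (c : ℝ) : EReal :=
  ⨅ u ∈ massSphere N c, energy γ₁ γ₂ u

end Hartree

end

noncomputable section

namespace Hartree

/-! ### Dilations of weakly differentiable functions -/

/-! Writing `u = √c v` with `v` of mass one multiplies the Dirichlet term by `c` and the Hartree
terms by `c²`. Hence `m(c) = c f(c)`, where `f(c)` is the infimum over `v` of `A/2 + (c/4) D`, with
`A` the Dirichlet integral of `v` and `D` its `γ₂` Hartree term minus its `γ₁` one
(`groundEnergy_eq`). An infimum of affine functions is concave, so `f` is continuous on the open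
half-line. Mass-preserving spreading of `v` sends `A/2 + (c/4) D` to `0`, so `f ≤ 0`; then `f` is
nonincreasing, because members with `D ≤ 0` decrease in `c` and those with `D ≥ 0` are nonnegative.
Subadditivity, monotonicity and the limit at `0` are arithmetic from there. Concentrating `v` makes
the `γ₁` term win, so some `D` is negative, which gives the limit at infinity.

The analytic point is that `f` is finite. A Hardy-type inequality bounds `∫ |u|²/|x-y|^γ dx` by the
squared `H¹` norm, uniformly in `y` (`lintegral_div_rpow_le`). It comes from integrating by parts
against a regularized radial field (`integral_regKernel_le`), then removing the smoothness
assumption and the regularization by mollification and Fatou. Integrating in `y` bounds the Hartree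
term, and a dilation makes its gradient coefficient arbitrarily small because `γ < 2`
(`toReal_hartree_le`), so the kinetic energy absorbs it. -/

theorem gradSq_eq {N : ℕ} {u : Space N → ℂ} {g : Fin N → Space N → ℂ}
    (hg : ∀ i, IsWeakPartial i u (g i)) : gradSq u = ∑ i, ∫⁻ x, ‖g i x‖ₑ ^ 2 := by
  unfold gradSq
  refine Finset.sum_congr rfl fun i _ => lintegral_congr_ae ?_
  filter_upwards [(hg i).weakPartial.ae_eq (hg i)] with x hx
  rw [hx]

theorem MemH1.exists_weakPartial {N : ℕ} {u : Space N → ℂ} (hu : MemH1 u) :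
    ∃ g : Fin N → Space N → ℂ, ∀ i, MemLp (g i) 2 volume ∧ IsWeakPartial i u (g i) := by
  choose g hg using hu.2
  exact ⟨g, hg⟩

theorem lintegral_enorm_sq_ne_top {N : ℕ} {u : Space N → ℂ} (hu : MemLp u 2 volume) :
    ∫⁻ x, ‖u x‖ₑ ^ 2 ≠ ⊤ := by
  have := lintegral_rpow_enorm_lt_top_of_eLpNorm_lt_top (p := 2) (by simp) (by simp) hu.2
  simpa using this.ne

theorem MemH1.gradSq_ne_top {N : ℕ} {u : Space N → ℂ} (hu : MemH1 u) : gradSq u ≠ ⊤ := by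
  obtain ⟨g, hg⟩ := hu.exists_weakPartial
  rw [gradSq_eq fun i => (hg i).2]
  exact ENNReal.sum_ne_top.2 fun i _ => lintegral_enorm_sq_ne_top (hg i).1

theorem ofReal_integral_norm_sq {N : ℕ} {u : Space N → ℂ} (hu : MemLp u 2 volume) :
    ENNReal.ofReal (∫ x, ‖u x‖ ^ 2) = ∫⁻ x, ‖u x‖ₑ ^ 2 := by
  rw [ofReal_integral_eq_lintegral_ofReal (hu.integrable_norm_pow (p := 2) (by norm_num))
    (ae_of_all _ fun x => by positivity)]
  refine lintegral_congr fun x => ?_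
  rw [ENNReal.ofReal_pow (norm_nonneg _), ofReal_norm]

theorem lintegral_comp_smul {N : ℕ} (f : Space N → ℝ≥0∞) {l : ℝ} (hl : 0 < l) :
    ∫⁻ x, f (l • x) = ENNReal.ofReal (l ^ (-N : ℝ)) * ∫⁻ x, f x := by
  have h := lintegral_map_equiv (μ := (volume : Measure (Space N))) f
    (Homeomorph.smulOfNeZero l hl.ne').toMeasurableEquiv
  have h2 := Measure.map_addHaar_smul (volume : Measure (Space N)) hl.ne'
  have h3 : ((Homeomorph.smulOfNeZero l hl.ne').toMeasurableEquiv : Space N → Space N)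
      = fun x => l • x := rfl
  rw [h3, h2, lintegral_smul_measure, finrank_euclideanSpace_fin, smul_eq_mul] at h
  rw [← h, abs_of_pos (by positivity), Real.rpow_neg hl.le, Real.rpow_natCast]

theorem memLp_comp_smul {N : ℕ} {u : Space N → ℂ} (hu : MemLp u 2 volume) {l : ℝ} (hl : 0 < l) :
    MemLp (fun x => u (l • x)) 2 volume := by
  have h := MeasurableEquiv.memLp_map_measure_iff
    (f := (Homeomorph.smulOfNeZero l hl.ne').toMeasurableEquiv)
    (μ := (volume : Measure (Space N))) (g := u) (p := 2)
  have h2 := Measure.map_addHaar_smul (volume : Measure (Space N)) hl.ne'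
  have h3 : ((Homeomorph.smulOfNeZero l hl.ne').toMeasurableEquiv : Space N → Space N)
      = fun x => l • x := rfl
  rw [h3, h2] at h
  exact h.1 (hu.smul_measure ENNReal.ofReal_ne_top)

/-- The rescaled function `x ↦ a u(l x)`. -/
def dilate {N : ℕ} (a l : ℝ) (u : Space N → ℂ) : Space N → ℂ := fun x => a • u (l • x)

theorem memLp_dilate {N : ℕ} {u : Space N → ℂ} (hu : MemLp u 2 volume) (a : ℝ) {l : ℝ}
    (hl : 0 < l) : MemLp (dilate a l u) 2 volume :=
  (memLp_comp_smul hu hl).const_smul a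

theorem lintegral_enorm_sq_dilate {N : ℕ} (u : Space N → ℂ) (a : ℝ) {l : ℝ} (hl : 0 < l) :
    ∫⁻ x, ‖dilate a l u x‖ₑ ^ 2 = ENNReal.ofReal (a ^ 2 * l ^ (-N : ℝ)) * ∫⁻ x, ‖u x‖ₑ ^ 2 := by
  have h : ∀ x, ‖dilate a l u x‖ₑ ^ 2 = ENNReal.ofReal (a ^ 2) * ‖u (l • x)‖ₑ ^ 2 := fun x => by
    rw [dilate, enorm_smul, mul_pow, ← ofReal_norm a, ← ENNReal.ofReal_pow (norm_nonneg _),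
      Real.norm_eq_abs, sq_abs]
  simp_rw [h]
  rw [lintegral_const_mul' _ _ ENNReal.ofReal_ne_top,
    lintegral_comp_smul (fun x => ‖u x‖ₑ ^ 2) hl, ENNReal.ofReal_mul (sq_nonneg a), mul_assoc]

theorem IsWeakPartial.dilate {N : ℕ} {i : Fin N} {u g : Space N → ℂ} (hu : MemLp u 2 volume)
    (hg : MemLp g 2 volume) (h : IsWeakPartial i u g) (a : ℝ) {l : ℝ} (hl : 0 < l) :
    IsWeakPartial i (dilate a l u) (Hartree.dilate (a * l) l g) := by
  refine ⟨(memLp_dilate hu a hl).locallyIntegrable (by norm_num),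
    (memLp_dilate hg _ hl).locallyIntegrable (by norm_num), fun φ hφ hs => ?_⟩
  set ψ : Space N → ℝ := fun y => φ (l⁻¹ • y) with hψ
  have hl' : l⁻¹ ≠ 0 := inv_ne_zero hl.ne'
  have hψs : HasCompactSupport ψ := hs.comp_homeomorph (Homeomorph.smulOfNeZero l⁻¹ hl')
  have key := h.2.2 ψ (hφ.comp (contDiff_const_smul l⁻¹)) hψs
  have hd : ∀ y, fderiv ℝ φ (l⁻¹ • y) = l • fderiv ℝ ψ y := fun y => by
    rw [hψ, fderiv_comp_smul, smul_smul, mul_inv_cancel₀ hl.ne', one_smul]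
  have e1 : ∀ x, (fderiv ℝ φ x (EuclideanSpace.single i 1)) • Hartree.dilate a l u x
      = (fun y => (a * l) • ((fderiv ℝ ψ y (EuclideanSpace.single i 1)) • u y)) (l • x) := by
    intro x
    have := hd (l • x)
    rw [smul_smul, inv_mul_cancel₀ hl.ne', one_smul] at this
    simp only [this, Hartree.dilate, smul_apply, smul_smul, smul_eq_mul]
    congr 1; ring
  have e2 : ∀ x, φ x • Hartree.dilate (a * l) l g x
      = (fun y => (a * l) • (ψ y • g y)) (l • x) := by
    intro x
    simp only [hψ, Hartree.dilate, smul_smul, inv_mul_cancel₀ hl.ne', one_smul]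
    congr 1; ring
  simp_rw [e1, e2]
  rw [Measure.integral_comp_smul volume
      (fun y => (a * l) • ((fderiv ℝ ψ y (EuclideanSpace.single i 1)) • u y)),
    Measure.integral_comp_smul volume (fun y => (a * l) • (ψ y • g y)),
    integral_smul, integral_smul, key, smul_neg, smul_neg]

theorem MemH1.dilate {N : ℕ} {u : Space N → ℂ} (hu : MemH1 u) (a : ℝ) {l : ℝ} (hl : 0 < l) :
    MemH1 (dilate a l u) := by
  refine ⟨memLp_dilate hu.1 a hl, fun i => ?_⟩
  obtain ⟨g, hg, hw⟩ := hu.2 i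
  exact ⟨_, memLp_dilate hg _ hl, hw.dilate hu.1 hg a hl⟩

theorem gradSq_dilate {N : ℕ} {u : Space N → ℂ} (hu : MemH1 u) (a : ℝ) {l : ℝ} (hl : 0 < l) :
    gradSq (dilate a l u) = ENNReal.ofReal (a ^ 2 * l ^ (2 - N : ℝ)) * gradSq u := by
  obtain ⟨g, hg⟩ := hu.exists_weakPartial
  rw [gradSq_eq fun i => (hg i).2, gradSq_eq fun i => (hg i).2.dilate hu.1 (hg i).1 a hl,
    Finset.mul_sum]
  refine Finset.sum_congr rfl fun i _ => ?_
  rw [lintegral_enorm_sq_dilate _ _ hl, sub_eq_add_neg, Real.rpow_add hl, Real.rpow_two,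
    mul_pow, mul_assoc]

/-- The kernel contributes `l ^ γ`, and each of the two changes of variables contributes `l ^ (-N)`.
-/
theorem hartree_dilate {N : ℕ} (γ : ℝ) (u : Space N → ℂ) (a : ℝ) {l : ℝ} (hl : 0 < l) :
    hartree γ (dilate a l u) = ENNReal.ofReal (a ^ 4 * l ^ (γ - 2 * N)) * hartree γ u := by
  set K : ℝ≥0∞ := ENNReal.ofReal (a ^ 4 * l ^ γ) with hK
  have h : ∀ x y, ‖dilate a l u x‖ₑ ^ 2 * ‖dilate a l u y‖ₑ ^ 2 / ‖x - y‖ₑ ^ γ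
      = K * (‖u (l • x)‖ₑ ^ 2 * ‖u (l • y)‖ₑ ^ 2 / ‖l • x - l • y‖ₑ ^ γ) := by
    intro x y
    have e : ‖l • x - l • y‖ₑ ^ γ = ENNReal.ofReal (l ^ γ) * ‖x - y‖ₑ ^ γ := by
      rw [← smul_sub, enorm_smul, ENNReal.mul_rpow_of_ne_top enorm_ne_top enorm_ne_top,
        Real.enorm_eq_ofReal hl.le, ENNReal.ofReal_rpow_of_pos hl]
    have e2 : ENNReal.ofReal (a ^ 4) = ‖a‖ₑ ^ 4 := by
      rw [← ofReal_norm a, ← ENNReal.ofReal_pow (norm_nonneg _), Real.norm_eq_abs,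
        Even.pow_abs (by decide)]
    have hp : ENNReal.ofReal (l ^ γ) ≠ 0 := by
      simpa using Real.rpow_pos_of_pos hl γ
    rw [e, hK, ENNReal.ofReal_mul (by positivity), e2, dilate, dilate, enorm_smul, enorm_smul,
      div_eq_mul_inv, div_eq_mul_inv, ENNReal.mul_inv (Or.inl hp) (Or.inl ENNReal.ofReal_ne_top)]
    calc _ = ‖a‖ₑ ^ 4 * 1 * (‖u (l • x)‖ₑ ^ 2 * ‖u (l • y)‖ₑ ^ 2 * (‖x - y‖ₑ ^ γ)⁻¹) := by ring
      _ = _ := by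
        rw [← ENNReal.mul_inv_cancel hp ENNReal.ofReal_ne_top]
        ring
  unfold hartree
  simp_rw [h]
  have hKt : K ≠ ⊤ := ENNReal.ofReal_ne_top
  simp_rw [lintegral_const_mul' K _ hKt]
  have h2 : ∀ x : Space N, ∫⁻ y, ‖u (l • x)‖ₑ ^ 2 * ‖u (l • y)‖ₑ ^ 2 / ‖l • x - l • y‖ₑ ^ γ
      = ENNReal.ofReal (l ^ (-N : ℝ)) *
        ∫⁻ y, ‖u (l • x)‖ₑ ^ 2 * ‖u y‖ₑ ^ 2 / ‖l • x - y‖ₑ ^ γ := fun x =>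
    lintegral_comp_smul (fun y => ‖u (l • x)‖ₑ ^ 2 * ‖u y‖ₑ ^ 2 / ‖l • x - y‖ₑ ^ γ) hl
  simp_rw [h2, lintegral_const_mul' _ _ ENNReal.ofReal_ne_top]
  rw [lintegral_comp_smul (fun x => ∫⁻ y, ‖u x‖ₑ ^ 2 * ‖u y‖ₑ ^ 2 / ‖x - y‖ₑ ^ γ) hl,
    ← mul_assoc, ← mul_assoc, hK, ← ENNReal.ofReal_mul (by positivity),
    ← ENNReal.ofReal_mul (by positivity), mul_assoc, mul_assoc, ← Real.rpow_add hl,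
    ← Real.rpow_add hl]
  congr 4; ring

/-! ### Mollification -/

/-- Convolution with a probability density is a contraction of `L²`. -/
theorem lintegral_enorm_sq_convolution_le {N : ℕ} {ρ : Space N → ℝ} (hρ : Continuous ρ)
    (h1 : ∫⁻ t, ‖ρ t‖ₑ = 1) {w : Space N → ℂ} (hw : AEStronglyMeasurable w volume) :
    ∫⁻ x, ‖convolution ρ w (ContinuousLinearMap.lsmul ℝ ℝ) volume x‖ₑ ^ 2
      ≤ ∫⁻ x, ‖w x‖ₑ ^ 2 := by
  have hρm : Measurable fun t => ‖ρ t‖ₑ := hρ.measurable.enorm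
  have pt : ∀ x, ‖convolution ρ w (ContinuousLinearMap.lsmul ℝ ℝ) volume x‖ₑ ^ 2
      ≤ ∫⁻ t, ‖ρ t‖ₑ * ‖w (x - t)‖ₑ ^ 2 := by
    intro x
    have hwx : AEMeasurable (fun t => ‖w (x - t)‖ₑ) volume :=
      (hw.comp_quasiMeasurePreserving
        (quasiMeasurePreserving_sub_left volume x)).enorm
    -- Cauchy–Schwarz after splitting `|ρ|` into two square roots; the factor that carries only `ρ`
    -- integrates to `1`.
    have hh := ENNReal.lintegral_mul_le_Lp_mul_Lq volume Real.HolderConjugate.two_two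
      (f := fun t => ‖ρ t‖ₑ ^ (1 / 2 : ℝ)) (g := fun t => ‖ρ t‖ₑ ^ (1 / 2 : ℝ) * ‖w (x - t)‖ₑ)
      (hρm.pow_const _).aemeasurable ((hρm.pow_const _).aemeasurable.mul hwx)
    have e0 : ∀ r : ℝ≥0∞, (r ^ (1 / 2 : ℝ)) ^ (2 : ℝ) = r := fun r => by
      rw [← ENNReal.rpow_mul]; norm_num
    have e1 : ∀ t, ‖ρ t‖ₑ ^ (1 / 2 : ℝ) * (‖ρ t‖ₑ ^ (1 / 2 : ℝ) * ‖w (x - t)‖ₑ)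
        = ‖ρ t‖ₑ * ‖w (x - t)‖ₑ := fun t => by
      rw [← mul_assoc, ← ENNReal.rpow_add_of_nonneg _ _ (by norm_num) (by norm_num)]; norm_num
    simp only [Pi.mul_apply, e1, ENNReal.mul_rpow_of_nonneg _ _ (zero_le_two : (0:ℝ) ≤ 2), e0, h1,
      ENNReal.one_rpow, one_mul, ENNReal.rpow_two] at hh
    have h2 : ‖convolution ρ w (ContinuousLinearMap.lsmul ℝ ℝ) volume x‖ₑ
        ≤ ∫⁻ t, ‖ρ t‖ₑ * ‖w (x - t)‖ₑ := by
      rw [convolution_def]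
      refine (enorm_integral_le_lintegral_enorm _).trans (le_of_eq (lintegral_congr fun t => ?_))
      rw [ContinuousLinearMap.lsmul_apply, enorm_smul]
    calc _ ≤ ((∫⁻ t, ‖ρ t‖ₑ * ‖w (x - t)‖ₑ ^ 2) ^ (1 / 2 : ℝ)) ^ 2 := by
          gcongr; exact h2.trans hh
      _ = _ := by rw [← ENNReal.rpow_two, e0]
  refine (lintegral_mono pt).trans ?_
  rw [lintegral_lintegral_swap]
  · have : ∀ t, ∫⁻ x, ‖ρ t‖ₑ * ‖w (x - t)‖ₑ ^ 2 = ‖ρ t‖ₑ * ∫⁻ x, ‖w x‖ₑ ^ 2 := fun t => by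
      rw [lintegral_const_mul' _ _ enorm_ne_top,
        lintegral_sub_right_eq_self (fun x => ‖w x‖ₑ ^ 2) t]
    simp_rw [this]
    rw [lintegral_mul_const _ hρm, h1, one_mul]
  · have hw2 : AEStronglyMeasurable (fun p : Space N × Space N => w (p.1 - p.2))
        (volume.prod volume) :=
      hw.comp_quasiMeasurePreserving (quasiMeasurePreserving_sub_of_right_invariant volume volume)
    exact (hρm.comp measurable_snd).aemeasurable.mul (hw2.enorm.pow_const 2)

/-- The derivative falls on `ρ`, and `s ↦ ρ (x - s)` is an admissible test function. The sign from
the reflection cancels the one in the weak derivative. -/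
theorem IsWeakPartial.fderiv_convolution {N : ℕ} {i : Fin N} {u g : Space N → ℂ}
    (h : IsWeakPartial i u g) {ρ : Space N → ℝ} (hρ : ContDiff ℝ ∞ ρ) (hs : HasCompactSupport ρ)
    (x : Space N) :
    fderiv ℝ (convolution ρ u (ContinuousLinearMap.lsmul ℝ ℝ) volume) x
        (EuclideanSpace.single i 1)
      = convolution ρ g (ContinuousLinearMap.lsmul ℝ ℝ) volume x := by
  have hd := (hs.hasFDerivAt_convolution_left (ContinuousLinearMap.lsmul ℝ ℝ)
    (hρ.of_le (by exact_mod_cast le_top)) h.1 x).fderiv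
  have hex := (hs.fderiv ℝ).convolutionExists_left
    (ContinuousLinearMap.precompL (Space N) (ContinuousLinearMap.lsmul ℝ ℝ : ℝ →L[ℝ] ℂ →L[ℝ] ℂ))
    (hρ.continuous_fderiv (by simp)) h.1 x
  rw [hd, convolution_def, ContinuousLinearMap.integral_apply hex, convolution_eq_swap]
  simp only [ContinuousLinearMap.precompL_apply, ContinuousLinearMap.lsmul_apply]
  have hφ : ContDiff ℝ ∞ fun s => ρ (x - s) := hρ.comp (contDiff_const.sub contDiff_id)
  have hφs : HasCompactSupport fun s => ρ (x - s) := hs.comp_homeomorph (Homeomorph.subLeft x)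
  have key := h.2.2 _ hφ hφs
  have hfd : ∀ s, fderiv ℝ (fun s => ρ (x - s)) s = -fderiv ℝ ρ (x - s) := fun s => by
    have := (((hρ.differentiable (by simp)) (x - s)).hasFDerivAt.comp s
      ((hasFDerivAt_id s).const_sub x)).fderiv
    refine this.trans ?_
    ext; simp
  simp only [hfd, neg_apply, neg_smul, integral_neg, neg_inj] at key
  rw [← key, ← integral_sub_left_eq_self _ volume x]
  simp

/-! ### Integration by parts against a regularized singular vector field -/

/-- A regularization of `s^(-γ/2) / (1 + s)`. -/
def regKernel (γ δ s : ℝ) : ℝ := (s + δ) ^ (-(γ / 2)) * (1 + s)⁻¹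

theorem regKernel_nonneg {γ δ s : ℝ} (hδ : 0 < δ) (hs : 0 ≤ s) : 0 ≤ regKernel γ δ s := by
  unfold regKernel; positivity

/-- A crude bound that blows up as `δ → 0`; it serves only to make integrals converge and never
enters the final constant. -/
theorem regKernel_le {γ δ s : ℝ} (hγ : 0 < γ) (hδ : 0 < δ) (hs : 0 ≤ s) :
    (1 + s) * regKernel γ δ s ≤ δ ^ (-(γ / 2)) := by
  have : (1 + s) * regKernel γ δ s = (s + δ) ^ (-(γ / 2)) := by
    unfold regKernel; field_simp
  rw [this]
  exact Real.rpow_le_rpow_of_nonpos hδ (by linarith) (by linarith)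

/-- Here `γ < 2` matters: `s ^ (1 - γ/2) ≤ 1 + s`. Uniformity in `δ` is what lets the square of the
field be absorbed. -/
theorem mul_regKernel_le_one {γ δ s : ℝ} (hγ : 0 < γ) (hγ2 : γ < 2) (hδ : 0 < δ) (hs : 0 ≤ s) :
    s * regKernel γ δ s ≤ 1 := by
  unfold regKernel
  rcases hs.eq_or_lt with rfl | hs
  · simp
  have h1 : (s + δ) ^ (-(γ / 2)) ≤ s ^ (-(γ / 2)) :=
    Real.rpow_le_rpow_of_nonpos hs (by linarith) (by linarith)
  have h2 : s * s ^ (-(γ / 2)) ≤ 1 + s := by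
    have : s * s ^ (-(γ / 2)) = s ^ (1 - γ / 2) := by
      rw [sub_eq_add_neg, Real.rpow_add hs, Real.rpow_one]
    rw [this]
    rcases le_total s 1 with h | h
    · exact (Real.rpow_le_one hs.le h (by linarith)).trans (by linarith)
    · calc s ^ (1 - γ / 2) ≤ s ^ (1 : ℝ) := Real.rpow_le_rpow_of_exponent_le h (by linarith)
        _ ≤ 1 + s := by rw [Real.rpow_one]; linarith
  rw [← mul_assoc, ← div_eq_mul_inv, div_le_one (by linarith)]
  exact (mul_le_mul_of_nonneg_left h1 hs.le).trans h2

theorem hasDerivAt_regKernel {γ δ s : ℝ} (hδ : 0 < δ) (hs : 0 ≤ s) :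
    HasDerivAt (regKernel γ δ) (-(regKernel γ δ s * (γ / 2 / (s + δ) + 1 / (1 + s)))) s := by
  have hp : s + δ ≠ 0 := by positivity
  have hq : (1 : ℝ) + s ≠ 0 := by positivity
  have h1 := ((hasDerivAt_id s).add_const δ).rpow_const (p := -(γ / 2)) (Or.inl hp)
  have h2 := ((hasDerivAt_id s).const_add 1).inv hq
  refine (h1.mul h2).congr_deriv ?_
  have : (s + δ) ^ (-(γ / 2) - 1) = (s + δ) ^ (-(γ / 2)) / (s + δ) := Real.rpow_sub_one hp _
  simp only [regKernel, id, this, Pi.inv_apply]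
  field_simp
  ring

/-- Summed over `i`, these derivatives give the divergence of the field `z h(|z|²)`, where `z = x -
y` and `h` is the regularized kernel. -/
theorem hasFDerivAt_field {N : ℕ} {γ δ : ℝ} (hδ : 0 < δ) (i : Fin N) (y x : Space N) :
    ∃ L : Space N →L[ℝ] ℝ,
      HasFDerivAt (fun x : Space N => (x - y) i * regKernel γ δ (‖x - y‖ ^ 2)) L x ∧
      L (EuclideanSpace.single i 1) = regKernel γ δ (‖x - y‖ ^ 2) *
        (1 - ((x - y) i) ^ 2 * (γ / (‖x - y‖ ^ 2 + δ) + 2 / (1 + ‖x - y‖ ^ 2))) := by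
  have h0 := (hasFDerivAt_id (𝕜 := ℝ) x).sub_const y
  have h1 := h0.norm_sq
  have h2 := (hasDerivAt_regKernel (γ := γ) hδ (sq_nonneg ‖x - y‖)).comp_hasFDerivAt x h1
  have h3 := (EuclideanSpace.proj i : Space N →L[ℝ] ℝ).hasFDerivAt.comp x h0
  refine ⟨_, h3.mul h2, ?_⟩
  simp [EuclideanSpace.inner_single_right]
  ring

theorem continuous_regKernel_norm {N : ℕ} {γ δ : ℝ} (hδ : 0 < δ) (y : Space N) :
    Continuous fun x : Space N => regKernel γ δ (‖x - y‖ ^ 2) := by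
  unfold regKernel
  refine Continuous.mul (Continuous.rpow_const (by fun_prop) fun x => Or.inl (by positivity))
    (Continuous.inv₀ (by fun_prop) fun x => by positivity)

theorem abs_field_le {N : ℕ} {γ δ : ℝ} (hγ : 0 < γ) (hδ : 0 < δ) (i : Fin N) (z : Space N) :
    |z i * regKernel γ δ (‖z‖ ^ 2)| ≤ δ ^ (-(γ / 2)) := by
  have h := regKernel_le hγ hδ (sq_nonneg ‖z‖)
  have h0 := regKernel_nonneg (γ := γ) hδ (sq_nonneg ‖z‖)
  have hz : |z i| ≤ ‖z‖ := by simpa using PiLp.norm_apply_le z i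
  rw [abs_mul, abs_of_nonneg h0]
  refine le_trans ?_ h
  gcongr
  nlinarith [sq_nonneg (‖z‖ - 1), norm_nonneg z]

theorem sq_apply_le {N : ℕ} (i : Fin N) (z : Space N) : (z i) ^ 2 ≤ ‖z‖ ^ 2 := by
  have hz : |z i| ≤ ‖z‖ := by simpa using PiLp.norm_apply_le z i
  exact sq_le_sq' (abs_le.1 hz).1 (abs_le.1 hz).2

theorem abs_field_deriv_le {N : ℕ} {γ δ : ℝ} (hγ : 0 < γ) (hδ : 0 < δ) (i : Fin N)
    (z : Space N) :
    |regKernel γ δ (‖z‖ ^ 2) * (1 - (z i) ^ 2 * (γ / (‖z‖ ^ 2 + δ) + 2 / (1 + ‖z‖ ^ 2)))|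
      ≤ δ ^ (-(γ / 2)) * (3 + γ) := by
  have hz := sq_apply_le i z
  have hb : (z i) ^ 2 * (γ / (‖z‖ ^ 2 + δ) + 2 / (1 + ‖z‖ ^ 2)) ≤ γ + 2 := by
    calc (z i) ^ 2 * (γ / (‖z‖ ^ 2 + δ) + 2 / (1 + ‖z‖ ^ 2))
        ≤ ‖z‖ ^ 2 * (γ / (‖z‖ ^ 2 + δ) + 2 / (1 + ‖z‖ ^ 2)) := by gcongr
      _ = γ * (‖z‖ ^ 2 / (‖z‖ ^ 2 + δ)) + 2 * (‖z‖ ^ 2 / (1 + ‖z‖ ^ 2)) := by ring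
      _ ≤ γ * 1 + 2 * 1 := by
        gcongr
        · rw [div_le_one (by positivity)]; linarith
        · rw [div_le_one (by positivity)]; linarith
      _ = _ := by ring
  have h0 := regKernel_nonneg (γ := γ) hδ (sq_nonneg ‖z‖)
  have h1 : regKernel γ δ (‖z‖ ^ 2) ≤ δ ^ (-(γ / 2)) :=
    le_trans (le_mul_of_one_le_left h0 (by nlinarith [sq_nonneg ‖z‖]))
      (regKernel_le hγ hδ (sq_nonneg ‖z‖))
  have h2 : 0 ≤ (z i) ^ 2 * (γ / (‖z‖ ^ 2 + δ) + 2 / (1 + ‖z‖ ^ 2)) := by positivity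
  rw [abs_mul, abs_of_nonneg h0]
  gcongr
  rw [abs_le]; constructor <;> linarith

/-- Integration by parts against the `i`-th component of the vector field. -/
theorem integral_field_deriv_le {N : ℕ} {γ δ κ : ℝ} (hγ : 0 < γ) (hδ : 0 < δ) (hκ : 0 < κ)
    {v : Space N → ℂ} (hv : Differentiable ℝ v) (hv2 : MemLp v 2 volume) (i : Fin N)
    (hd : MemLp (fun x => fderiv ℝ v x (EuclideanSpace.single i 1)) 2 volume) (y : Space N) :
    Integrable (fun x => κ / 2 * ((x - y) i * regKernel γ δ (‖x - y‖ ^ 2)) ^ 2 * ‖v x‖ ^ 2 +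
        2 / κ * ‖fderiv ℝ v x (EuclideanSpace.single i 1)‖ ^ 2 -
        (regKernel γ δ (‖x - y‖ ^ 2) * (1 - ((x - y) i) ^ 2 *
          (γ / (‖x - y‖ ^ 2 + δ) + 2 / (1 + ‖x - y‖ ^ 2)))) * ‖v x‖ ^ 2) volume ∧
    0 ≤ ∫ x, (κ / 2 * ((x - y) i * regKernel γ δ (‖x - y‖ ^ 2)) ^ 2 * ‖v x‖ ^ 2 +
        2 / κ * ‖fderiv ℝ v x (EuclideanSpace.single i 1)‖ ^ 2 -
        (regKernel γ δ (‖x - y‖ ^ 2) * (1 - ((x - y) i) ^ 2 *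
          (γ / (‖x - y‖ ^ 2 + δ) + 2 / (1 + ‖x - y‖ ^ 2)))) * ‖v x‖ ^ 2) := by
  have hR := continuous_regKernel_norm (γ := γ) hδ y
  set F : Space N → ℝ := fun x => (x - y) i * regKernel γ δ (‖x - y‖ ^ 2) with hF
  set D : Space N → ℝ := fun x => regKernel γ δ (‖x - y‖ ^ 2) * (1 - ((x - y) i) ^ 2 *
        (γ / (‖x - y‖ ^ 2 + δ) + 2 / (1 + ‖x - y‖ ^ 2))) with hD
  set w : Space N → ℂ := fun x => fderiv ℝ v x (EuclideanSpace.single i 1) with hw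
  have hFc : Continuous F := by
    refine Continuous.mul ?_ hR
    fun_prop
  have hDc : Continuous D := by
    refine hR.mul (continuous_const.sub (Continuous.mul (by fun_prop) (Continuous.add ?_ ?_)))
    · exact Continuous.div (by fun_prop) (by fun_prop) fun x => by positivity
    · exact Continuous.div (by fun_prop) (by fun_prop) fun x => by positivity
  choose L hL hLe using fun x => hasFDerivAt_field (γ := γ) hδ i y x
  have hLf : ∀ x, fderiv ℝ F x (EuclideanSpace.single i 1) = D x := fun x => by
    rw [(hL x).fderiv, hLe]
  have hvf : ∀ x, fderiv ℝ (fun x => ‖v x‖ ^ 2) x (EuclideanSpace.single i 1)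
      = 2 * inner ℝ (v x) (w x) := fun x => by
    rw [((hv x).hasFDerivAt.norm_sq).fderiv]
    simp [hw]
    ring
  have iv : Integrable (fun x => ‖v x‖ ^ 2) volume := by
    simpa using hv2.integrable_norm_pow (p := 2) (by norm_num)
  have iw : Integrable (fun x => ‖w x‖ ^ 2) volume := by
    simpa using hd.integrable_norm_pow (p := 2) (by norm_num)
  have iF2 : Integrable (fun x => F x ^ 2 * ‖v x‖ ^ 2) volume := by
    refine iv.bdd_mul (c := (δ ^ (-(γ / 2))) ^ 2) (hFc.pow 2).aestronglyMeasurable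
      (ae_of_all _ fun x => ?_)
    rw [norm_pow]
    gcongr
    exact abs_field_le hγ hδ i (x - y)
  have iD : Integrable (fun x => D x * ‖v x‖ ^ 2) volume :=
    iv.bdd_mul (c := δ ^ (-(γ / 2)) * (3 + γ)) hDc.aestronglyMeasurable
      (ae_of_all _ fun x => abs_field_deriv_le hγ hδ i (x - y))
  have iF : Integrable (fun x => F x * ‖v x‖ ^ 2) volume :=
    iv.bdd_mul (c := δ ^ (-(γ / 2))) hFc.aestronglyMeasurable
      (ae_of_all _ fun x => abs_field_le hγ hδ i (x - y))
  have iR : Integrable (fun x => κ / 2 * F x ^ 2 * ‖v x‖ ^ 2 + 2 / κ * ‖w x‖ ^ 2) volume := by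
    exact ((iF2.const_mul (κ / 2)).add (iw.const_mul (2 / κ))).congr
      (ae_of_all _ fun x => by simp [mul_assoc])
  -- Young's inequality by completing a square. The weight `κ/2` is chosen so that, with `κ = N -
  -- γ`, only half of the divergence is used up.
  have pt : ∀ x, |F x * (2 * inner ℝ (v x) (w x))|
      ≤ κ / 2 * F x ^ 2 * ‖v x‖ ^ 2 + 2 / κ * ‖w x‖ ^ 2 := fun x => by
    have h1 : |inner ℝ (v x) (w x)| ≤ ‖v x‖ * ‖w x‖ := abs_real_inner_le_norm _ _
    have h2 : κ / 2 * F x ^ 2 * ‖v x‖ ^ 2 + 2 / κ * ‖w x‖ ^ 2 - |F x| * (2 * (‖v x‖ * ‖w x‖))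
        = κ / 2 * (|F x| * ‖v x‖ - 2 / κ * ‖w x‖) ^ 2 := by
      rw [← sq_abs (F x)]; field_simp; ring
    have h3 : 0 ≤ κ / 2 * (|F x| * ‖v x‖ - 2 / κ * ‖w x‖) ^ 2 := by positivity
    rw [abs_mul (F x), abs_mul 2, abs_two]
    calc |F x| * (2 * |inner ℝ (v x) (w x)|) ≤ |F x| * (2 * (‖v x‖ * ‖w x‖)) := by gcongr
      _ ≤ _ := by linarith
  have iFg : Integrable (fun x => F x * (2 * inner ℝ (v x) (w x))) volume := by
    refine iR.mono' (hFc.aestronglyMeasurable.mul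
      ((hv2.1.inner hd.1).const_mul 2)) (ae_of_all _ pt)
  have parts := integral_mul_fderiv_eq_neg_fderiv_mul_of_integrable (μ := volume)
    (f := F) (g := fun x => ‖v x‖ ^ 2) (v := EuclideanSpace.single i (1 : ℝ))
    (by simpa only [hLf] using iD) (by simpa only [hvf] using iFg) iF
    (fun x _ => (hL x).differentiableAt) (fun x _ => (hv x).norm_sq ℝ)
  simp only [hLf, hvf] at parts
  have : ∫ x, D x * ‖v x‖ ^ 2 = ∫ x, -(F x * (2 * inner ℝ (v x) (w x))) := by
    rw [integral_neg, parts, neg_neg]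
  refine ⟨iR.sub iD, ?_⟩
  rw [integral_sub iR iD, this, sub_nonneg]
  exact integral_mono iFg.neg iR fun x => (neg_le_abs _).trans (pt x)

/-- With `z = x - y`, the divergence of `z h(|z|²)` is at least `(N - γ) h - 2`, while the squared
length of the field is `|z|² h² ≤ h`. Summing the integrations by parts over `i`, the Young term
costs half of `(N - γ) h` and the other half remains. -/
theorem integral_regKernel_le {N : ℕ} {γ δ : ℝ} (hγ : 0 < γ) (hγN : γ < N) (hγ2 : γ < 2)
    (hδ : 0 < δ) {v : Space N → ℂ} (hv : Differentiable ℝ v) (hv2 : MemLp v 2 volume)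
    (hd : ∀ i, MemLp (fun x => fderiv ℝ v x (EuclideanSpace.single i 1)) 2 volume)
    (y : Space N) :
    (N - γ) / 2 * ∫ x, regKernel γ δ (‖x - y‖ ^ 2) * ‖v x‖ ^ 2
      ≤ 2 * (∫ x, ‖v x‖ ^ 2) +
        2 / (N - γ) * ∑ i, ∫ x, ‖fderiv ℝ v x (EuclideanSpace.single i 1)‖ ^ 2 := by
  set κ : ℝ := N - γ with hκdef
  have hκ : 0 < κ := sub_pos.2 hγN
  have hG := fun i => integral_field_deriv_le hγ hδ hκ hv hv2 i (hd i) y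
  have iv : Integrable (fun x => ‖v x‖ ^ 2) volume := by
    simpa using hv2.integrable_norm_pow (p := 2) (by norm_num)
  have iw : ∀ i, Integrable (fun x => ‖fderiv ℝ v x (EuclideanSpace.single i 1)‖ ^ 2) volume :=
    fun i => by simpa using (hd i).integrable_norm_pow (p := 2) (by norm_num)
  have ih : Integrable (fun x => regKernel γ δ (‖x - y‖ ^ 2) * ‖v x‖ ^ 2) volume := by
    refine iv.bdd_mul (c := δ ^ (-(γ / 2)))
      (continuous_regKernel_norm hδ y).aestronglyMeasurable (ae_of_all _ fun x => ?_)
    have h0 := regKernel_nonneg (γ := γ) hδ (sq_nonneg ‖x - y‖)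
    rw [Real.norm_of_nonneg h0]
    exact le_trans (le_mul_of_one_le_left h0 (by nlinarith [sq_nonneg ‖x - y‖]))
      (regKernel_le hγ hδ (sq_nonneg ‖x - y‖))
  have h1 := Finset.sum_nonneg fun i (_ : i ∈ Finset.univ) => (hG i).2
  rw [← integral_finsetSum _ fun i _ => (hG i).1] at h1
  have iS : Integrable (fun x => 2 / κ * ∑ i, ‖fderiv ℝ v x (EuclideanSpace.single i 1)‖ ^ 2)
      volume := (integrable_finsetSum _ fun i _ => iw i).const_mul _
  have h2 := h1.trans (integral_mono (integrable_finsetSum _ fun i _ => (hG i).1)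
    (((iv.const_mul 2).add iS).sub (ih.const_mul (κ / 2))) fun x => ?_)
  · simp only [Pi.sub_apply, Pi.add_apply] at h2
    have h3 := integral_sub ((iv.const_mul 2).add iS) (ih.const_mul (κ / 2))
    simp only [Pi.add_apply] at h3
    rw [h3, integral_add (iv.const_mul 2) iS, integral_const_mul, integral_const_mul,
      integral_const_mul, integral_finsetSum _ fun i _ => iw i] at h2
    linarith
  · set z := x - y with hz
    set h := regKernel γ δ (‖z‖ ^ 2) with hh
    have h0 : 0 ≤ h := regKernel_nonneg hδ (sq_nonneg ‖z‖)
    have hs1 : ‖z‖ ^ 2 * h ≤ 1 := mul_regKernel_le_one hγ hγ2 hδ (sq_nonneg ‖z‖)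
    have hsum : ∑ i, (z i) ^ 2 = ‖z‖ ^ 2 := by
      rw [EuclideanSpace.norm_sq_eq]; simp
    set K := γ / (‖z‖ ^ 2 + δ) + 2 / (1 + ‖z‖ ^ 2) with hK
    have hKs : ‖z‖ ^ 2 * K * h ≤ γ * h + 2 := by
      have e : ‖z‖ ^ 2 * K * h = γ * h * (‖z‖ ^ 2 / (‖z‖ ^ 2 + δ))
          + 2 * (‖z‖ ^ 2 * h) * (1 + ‖z‖ ^ 2)⁻¹ := by rw [hK]; ring
      have e1 : ‖z‖ ^ 2 / (‖z‖ ^ 2 + δ) ≤ 1 := by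
        rw [div_le_one (by positivity)]; linarith
      have e2 : (1 + ‖z‖ ^ 2)⁻¹ ≤ 1 := inv_le_one_of_one_le₀ (by nlinarith [sq_nonneg ‖z‖])
      rw [e]
      calc _ ≤ γ * h * 1 + 2 * 1 * 1 := by gcongr
        _ = _ := by ring
    have e : ∑ i, (κ / 2 * (z i * h) ^ 2 * ‖v x‖ ^ 2 +
        2 / κ * ‖fderiv ℝ v x (EuclideanSpace.single i 1)‖ ^ 2 -
        (h * (1 - (z i) ^ 2 * K)) * ‖v x‖ ^ 2)
        = (κ / 2 * (‖z‖ ^ 2 * h) * h - N * h + ‖z‖ ^ 2 * K * h) * ‖v x‖ ^ 2 +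
          2 / κ * ∑ i, ‖fderiv ℝ v x (EuclideanSpace.single i 1)‖ ^ 2 := by
      rw [← hsum]
      simp only [mul_pow, mul_sub, sub_mul, Finset.sum_sub_distrib, Finset.sum_add_distrib,
        ← Finset.mul_sum, ← Finset.sum_mul, add_mul, mul_one, Finset.sum_const, Finset.card_univ,
        Fintype.card_fin, nsmul_eq_mul, ← mul_assoc]
      simp only [mul_assoc]
      ring
    have hle : κ / 2 * (‖z‖ ^ 2 * h) * h - N * h + ‖z‖ ^ 2 * K * h ≤ 2 - κ / 2 * h := by
      have : κ / 2 * (‖z‖ ^ 2 * h) * h ≤ κ / 2 * 1 * h := by gcongr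
      have hN : (N : ℝ) = κ + γ := by rw [hκdef]; ring
      rw [hN]
      nlinarith
    simp only [Pi.sub_apply, Pi.add_apply]
    rw [e]
    have := mul_le_mul_of_nonneg_right hle (sq_nonneg ‖v x‖)
    linarith

/-! ### Hardy-type inequality and the Hartree bound -/

theorem memLp_two_of_lintegral {N : ℕ} {u : Space N → ℂ} (hu : AEStronglyMeasurable u volume)
    (h : ∫⁻ x, ‖u x‖ₑ ^ 2 ≠ ⊤) : MemLp u 2 volume := by
  refine ⟨hu, (eLpNorm_lt_top_iff_lintegral_rpow_enorm_lt_top (by simp) (by simp)).2 ?_⟩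
  simpa using h.lt_top

theorem lintegral_regKernel_le {N : ℕ} {γ δ : ℝ} (hγ : 0 < γ) (hγN : γ < N) (hγ2 : γ < 2)
    (hδ : 0 < δ) {v : Space N → ℂ} (hv : Differentiable ℝ v) (hv2 : MemLp v 2 volume)
    (hd : ∀ i, MemLp (fun x => fderiv ℝ v x (EuclideanSpace.single i 1)) 2 volume)
    (y : Space N) :
    ∫⁻ x, ENNReal.ofReal (regKernel γ δ (‖x - y‖ ^ 2)) * ‖v x‖ₑ ^ 2
      ≤ ENNReal.ofReal (4 / (N - γ) + 4 / (N - γ) ^ 2) * ((∫⁻ x, ‖v x‖ₑ ^ 2) +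
        ∑ i, ∫⁻ x, ‖fderiv ℝ v x (EuclideanSpace.single i 1)‖ₑ ^ 2) := by
  have hκ : 0 < N - γ := sub_pos.2 hγN
  have iv : Integrable (fun x => ‖v x‖ ^ 2) volume := by
    simpa using hv2.integrable_norm_pow (p := 2) (by norm_num)
  have ih : Integrable (fun x => regKernel γ δ (‖x - y‖ ^ 2) * ‖v x‖ ^ 2) volume := by
    refine iv.bdd_mul (c := δ ^ (-(γ / 2)))
      (continuous_regKernel_norm hδ y).aestronglyMeasurable (ae_of_all _ fun x => ?_)
    have h0 := regKernel_nonneg (γ := γ) hδ (sq_nonneg ‖x - y‖)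
    rw [Real.norm_of_nonneg h0]
    exact le_trans (le_mul_of_one_le_left h0 (by nlinarith [sq_nonneg ‖x - y‖]))
      (regKernel_le hγ hδ (sq_nonneg ‖x - y‖))
  have e : ∫⁻ x, ENNReal.ofReal (regKernel γ δ (‖x - y‖ ^ 2)) * ‖v x‖ₑ ^ 2
      = ENNReal.ofReal (∫ x, regKernel γ δ (‖x - y‖ ^ 2) * ‖v x‖ ^ 2) := by
    rw [ofReal_integral_eq_lintegral_ofReal ih (ae_of_all _ fun x =>
      mul_nonneg (regKernel_nonneg hδ (sq_nonneg _)) (sq_nonneg _))]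
    refine lintegral_congr fun x => ?_
    rw [ENNReal.ofReal_mul (regKernel_nonneg hδ (sq_nonneg _)),
      ENNReal.ofReal_pow (norm_nonneg _), ofReal_norm]
  have hS : ∀ i, 0 ≤ ∫ x, ‖fderiv ℝ v x (EuclideanSpace.single i 1)‖ ^ 2 := fun i =>
    integral_nonneg fun x => sq_nonneg _
  have hM : 0 ≤ ∫ x, ‖v x‖ ^ 2 := integral_nonneg fun x => sq_nonneg _
  rw [e, ← ofReal_integral_norm_sq hv2]
  simp_rw [← fun i => ofReal_integral_norm_sq (hd i)]
  rw [← ENNReal.ofReal_sum_of_nonneg fun i _ => hS i,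
    ← ENNReal.ofReal_add hM (Finset.sum_nonneg fun i _ => hS i),
    ← ENNReal.ofReal_mul (by positivity)]
  refine ENNReal.ofReal_le_ofReal ?_
  have h := integral_regKernel_le hγ hγN hγ2 hδ hv hv2 hd y
  set κ := (N : ℝ) - γ
  set S := ∑ i, ∫ x, ‖fderiv ℝ v x (EuclideanSpace.single i 1)‖ ^ 2
  have hS0 : 0 ≤ S := Finset.sum_nonneg fun i _ => hS i
  set M := ∫ x, ‖v x‖ ^ 2
  set H := ∫ x, regKernel γ δ (‖x - y‖ ^ 2) * ‖v x‖ ^ 2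
  -- The bound is weakened to have one common constant in front of mass and gradient.
  calc H = 2 / κ * (κ / 2 * H) := by field_simp
    _ ≤ 2 / κ * (2 * M + 2 / κ * S) := by gcongr
    _ = 4 / κ * M + 4 / κ ^ 2 * S := by field_simp; ring
    _ ≤ 4 / κ * M + 4 / κ ^ 2 * S + (4 / κ * S + 4 / κ ^ 2 * M) := by
      have : 0 ≤ 4 / κ * S + 4 / κ ^ 2 * M := by positivity
      linarith
    _ = _ := by ring

/-- A sequence of smooth compactly supported probability densities shrinking to the origin. -/
theorem exists_mollifier (N : ℕ) : ∃ ρ : ℕ → Space N → ℝ,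
    (∀ n, ContDiff ℝ ∞ (ρ n)) ∧ (∀ n, HasCompactSupport (ρ n)) ∧ (∀ n, ∫⁻ t, ‖ρ n t‖ₑ = 1) ∧
    ∀ w : Space N → ℂ, LocallyIntegrable w volume → ∀ᵐ x, Tendsto (fun n =>
      convolution (ρ n) w (ContinuousLinearMap.lsmul ℝ ℝ) volume x) atTop (𝓝 (w x)) := by
  let φ : ℕ → ContDiffBump (0 : Space N) := fun n =>
    ⟨1 / ((n : ℝ) + 1), 2 * (1 / ((n : ℝ) + 1)), by positivity, by
      have : (0 : ℝ) < 1 / ((n : ℝ) + 1) := by positivity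
      linarith⟩
  refine ⟨fun n => (φ n).normed volume, fun n => (φ n).contDiff_normed,
    fun n => (φ n).hasCompactSupport_normed, fun n => ?_, fun w hw => ?_⟩
  · have h := ofReal_integral_eq_lintegral_ofReal ((φ n).integrable_normed (μ := volume))
      (ae_of_all _ (φ n).nonneg_normed)
    rw [(φ n).integral_normed, ENNReal.ofReal_one] at h
    rw [h]
    refine lintegral_congr fun t => ?_
    rw [Real.enorm_eq_ofReal ((φ n).nonneg_normed t)]
  · refine ContDiffBump.ae_convolution_tendsto_right_of_locallyIntegrable (K := 2) ?_ ?_ hw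
    · have := (tendsto_one_div_add_atTop_nhds_zero_nat (𝕜 := ℝ)).const_mul 2
      rwa [mul_zero] at this
    · exact Eventually.of_forall fun n => le_rfl

/-- Hardy-type inequality for the regularized singular kernel. -/
theorem lintegral_kernel_le {N : ℕ} {γ : ℝ} (hγ : 0 < γ) (hγN : γ < N) (hγ2 : γ < 2)
    {u : Space N → ℂ} (hu : MemH1 u) (y : Space N) :
    ∫⁻ x, ENNReal.ofReal ((‖x - y‖ ^ 2) ^ (-(γ / 2)) * (1 + ‖x - y‖ ^ 2)⁻¹) * ‖u x‖ₑ ^ 2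
      ≤ ENNReal.ofReal (4 / (N - γ) + 4 / (N - γ) ^ 2) *
        ((∫⁻ x, ‖u x‖ₑ ^ 2) + gradSq u) := by
  obtain ⟨g, hg⟩ := hu.exists_weakPartial
  obtain ⟨ρ, hρ, hρs, hρ1, hρt⟩ := exists_mollifier N
  rw [gradSq_eq fun i => (hg i).2]
  have hul : LocallyIntegrable u volume := hu.1.locallyIntegrable (by norm_num)
  have hgl : ∀ i, LocallyIntegrable (g i) volume := fun i => (hg i).2.2.1
  set v : ℕ → Space N → ℂ := fun n => convolution (ρ n) u (ContinuousLinearMap.lsmul ℝ ℝ) volume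
  have hcd : ∀ n {w : Space N → ℂ}, LocallyIntegrable w volume →
      ContDiff ℝ ((1 : ℕ∞) : WithTop ℕ∞)
        (convolution (ρ n) w (ContinuousLinearMap.lsmul ℝ ℝ) volume) := fun n w hw =>
    (hρs n).contDiff_convolution_left _ ((hρ n).of_le (by exact_mod_cast le_top)) hw
  have hL2 : ∀ n {w : Space N → ℂ}, MemLp w 2 volume →
      MemLp (convolution (ρ n) w (ContinuousLinearMap.lsmul ℝ ℝ) volume) 2 volume := by
    intro n w hw
    refine memLp_two_of_lintegral
      (hcd n (hw.locallyIntegrable (by norm_num))).continuous.aestronglyMeasurable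
      (ne_top_of_le_ne_top (lintegral_enorm_sq_ne_top hw)
        (lintegral_enorm_sq_convolution_le (hρ n).continuous (hρ1 n) hw.1))
  have hfd : ∀ n i, (fun x => fderiv ℝ (v n) x (EuclideanSpace.single i 1)) =
      convolution (ρ n) (g i) (ContinuousLinearMap.lsmul ℝ ℝ) volume := fun n i =>
    funext fun x => (hg i).2.fderiv_convolution (hρ n) (hρs n) x
  set δ : ℕ → ℝ := fun n => 1 / ((n : ℝ) + 1)
  have hδ : ∀ n, 0 < δ n := fun n => by positivity
  have hδt : Tendsto δ atTop (𝓝 0) := tendsto_one_div_add_atTop_nhds_zero_nat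
  have hb : ∀ n, ∫⁻ x, ENNReal.ofReal (regKernel γ (δ n) (‖x - y‖ ^ 2)) * ‖v n x‖ₑ ^ 2
      ≤ ENNReal.ofReal (4 / (N - γ) + 4 / (N - γ) ^ 2) *
        ((∫⁻ x, ‖u x‖ₑ ^ 2) + ∑ i, ∫⁻ x, ‖g i x‖ₑ ^ 2) := by
    intro n
    refine (lintegral_regKernel_le hγ hγN hγ2 (hδ n) ((hcd n hul).differentiable (by simp))
      (hL2 n hu.1) (fun i => by rw [hfd]; exact hL2 n (hg i).1) y).trans ?_
    refine mul_le_mul_right (add_le_add ?_ (Finset.sum_le_sum fun i _ => ?_)) _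
    · exact lintegral_enorm_sq_convolution_le (hρ n).continuous (hρ1 n) hu.1.1
    · have := lintegral_enorm_sq_convolution_le (hρ n).continuous (hρ1 n) (hg i).1.1
      rw [← hfd n i] at this
      exact this
  -- Positive dimension makes the point `y` a null set. This is needed because the real power of `0`
  -- takes a default value, so the limit of the regularized kernels fails at `x = y`.
  have hN : 0 < N := by exact_mod_cast hγ.trans hγN
  have : Nonempty (Fin N) := ⟨⟨0, hN⟩⟩
  have hne : ∀ᵐ x : Space N, x ≠ y := by
    simp [ae_iff]
  have hlim : ∀ᵐ x, ENNReal.ofReal ((‖x - y‖ ^ 2) ^ (-(γ / 2)) * (1 + ‖x - y‖ ^ 2)⁻¹) * ‖u x‖ₑ ^ 2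
      = liminf (fun n => ENNReal.ofReal (regKernel γ (δ n) (‖x - y‖ ^ 2)) * ‖v n x‖ₑ ^ 2)
        atTop := by
    filter_upwards [hne, hρt u hul] with x hx hvx
    refine (Tendsto.liminf_eq ?_).symm
    have hs : 0 < ‖x - y‖ ^ 2 := by
      have := norm_pos_iff.2 (sub_ne_zero.2 hx)
      positivity
    refine ENNReal.Tendsto.mul ?_ (Or.inr (by simp)) ((ENNReal.continuous_pow 2).tendsto _ |>.comp
      ((continuous_enorm.tendsto _).comp hvx)) (Or.inr ENNReal.ofReal_ne_top)
    refine ENNReal.tendsto_ofReal (Tendsto.mul_const _ ?_)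
    have h1 : Tendsto (fun n => ‖x - y‖ ^ 2 + δ n) atTop (𝓝 (‖x - y‖ ^ 2)) := by
      simpa using hδt.const_add (‖x - y‖ ^ 2)
    exact h1.rpow_const (Or.inl hs.ne')
  rw [lintegral_congr_ae hlim]
  -- Fatou's lemma: the bound `hb` is independent of `n`, so it passes to the limit in mollification
  -- and regularization together.
  refine (lintegral_liminf_le' fun n => ?_).trans (liminf_le_of_le (by isBoundedDefault) ?_)
  · exact ((continuous_regKernel_norm (hδ n) y).measurable.ennreal_ofReal.mul
      ((hcd n hul).continuous.measurable.enorm.pow_const 2)).aemeasurable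
  · intro b hbb
    obtain ⟨n, hn⟩ := hbb.exists
    exact hn.trans (hb n)

theorem lintegral_div_rpow_le {N : ℕ} {γ : ℝ} (hγ : 0 < γ) (hγN : γ < N) (hγ2 : γ < 2)
    {u : Space N → ℂ} (hu : MemH1 u) (y : Space N) :
    ∫⁻ x, ‖u x‖ₑ ^ 2 / ‖y - x‖ₑ ^ γ
      ≤ ENNReal.ofReal (2 * (4 / (N - γ) + 4 / (N - γ) ^ 2) + 1) *
        ((∫⁻ x, ‖u x‖ₑ ^ 2) + gradSq u) := by
  have hN : 0 < N := by exact_mod_cast hγ.trans hγN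
  have hκ : 0 < N - γ := sub_pos.2 hγN
  have : Nonempty (Fin N) := ⟨⟨0, hN⟩⟩
  have hne : ∀ᵐ x : Space N, x ≠ y := by
    simp [ae_iff]
  have hpt : ∀ᵐ x, ‖u x‖ₑ ^ 2 / ‖y - x‖ₑ ^ γ ≤ 2 *
      (ENNReal.ofReal ((‖x - y‖ ^ 2) ^ (-(γ / 2)) * (1 + ‖x - y‖ ^ 2)⁻¹) * ‖u x‖ₑ ^ 2)
        + ‖u x‖ₑ ^ 2 := by
    filter_upwards [hne] with x hx
    have hp := norm_pos_iff.2 (sub_ne_zero.2 hx)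
    set r := ‖x - y‖ with hr
    have e1 : ‖y - x‖ₑ ^ γ = ENNReal.ofReal (r ^ γ) := by
      rw [← ofReal_norm, norm_sub_rev, ENNReal.ofReal_rpow_of_pos hp]
    have e2 : (r ^ 2) ^ (-(γ / 2)) = (r ^ γ)⁻¹ := by
      rw [← Real.rpow_natCast, ← Real.rpow_mul hp.le, ← Real.rpow_neg hp.le]
      congr 1; push_cast; ring
    -- The damping factor `(1 + r²)⁻¹` is at least `1/2` near the singularity; away from it `r ^
    -- (-γ) ≤ 1` and the mass alone suffices.
    have e3 : (r ^ γ)⁻¹ ≤ 2 * ((r ^ γ)⁻¹ * (1 + r ^ 2)⁻¹) + 1 := by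
      have h0 : 0 < r ^ γ := Real.rpow_pos_of_pos hp _
      rcases le_total r 1 with h | h
      · have h1 : (1 : ℝ) ≤ 2 * (1 + r ^ 2)⁻¹ := by
          rw [← div_eq_mul_inv, le_div_iff₀ (by positivity)]; nlinarith
        have : 0 < (r ^ γ)⁻¹ := by positivity
        nlinarith
      · have h1 : (r ^ γ)⁻¹ ≤ 1 := inv_le_one_of_one_le₀ (Real.one_le_rpow h hγ.le)
        have : 0 ≤ 2 * ((r ^ γ)⁻¹ * (1 + r ^ 2)⁻¹) := by positivity
        linarith
    rw [e1, e2, div_eq_mul_inv, ← ENNReal.ofReal_inv_of_pos (Real.rpow_pos_of_pos hp _), mul_comm]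
    calc _ ≤ ENNReal.ofReal (2 * ((r ^ γ)⁻¹ * (1 + r ^ 2)⁻¹) + 1) * ‖u x‖ₑ ^ 2 := by gcongr
      _ = _ := by
        rw [ENNReal.ofReal_add (by positivity) (by norm_num), ENNReal.ofReal_mul (by norm_num),
          ENNReal.ofReal_one]
        simp only [ENNReal.ofReal_ofNat]
        ring
  refine (lintegral_mono_ae hpt).trans ?_
  rw [lintegral_add_right' _ (hu.1.1.enorm.pow_const 2), lintegral_const_mul' _ _ (by simp)]
  rw [ENNReal.ofReal_add (by positivity) (by norm_num), ENNReal.ofReal_mul (by norm_num),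
    ENNReal.ofReal_one, add_mul, one_mul]
  simp only [ENNReal.ofReal_ofNat]
  rw [mul_assoc]
  exact add_le_add (mul_le_mul_right (lintegral_kernel_le hγ hγN hγ2 hu y) _) le_self_add

theorem hartree_le {N : ℕ} {γ : ℝ} (hγ : 0 < γ) (hγN : γ < N) (hγ2 : γ < 2)
    {u : Space N → ℂ} (hu : MemH1 u) :
    hartree γ u ≤ ENNReal.ofReal (2 * (4 / (N - γ) + 4 / (N - γ) ^ 2) + 1) *
        ((∫⁻ x, ‖u x‖ₑ ^ 2) + gradSq u) * ∫⁻ x, ‖u x‖ₑ ^ 2 := by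
  have hT : ∫⁻ x, ‖u x‖ₑ ^ 2 ≠ ⊤ := lintegral_enorm_sq_ne_top hu.1
  unfold hartree
  rw [← lintegral_const_mul' _ _ (ENNReal.mul_ne_top ENNReal.ofReal_ne_top
    (ENNReal.add_ne_top.2 ⟨hT, hu.gradSq_ne_top⟩))]
  refine lintegral_mono fun x => ?_
  simp_rw [mul_div_assoc]
  rw [lintegral_const_mul' _ _ (by simp), mul_comm]
  gcongr
  exact lintegral_div_rpow_le hγ hγN hγ2 hu x

theorem hartree_ne_top {N : ℕ} {γ : ℝ} (hγ : 0 < γ) (hγN : γ < N) (hγ2 : γ < 2)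
    {u : Space N → ℂ} (hu : MemH1 u) : hartree γ u ≠ ⊤ := by
  have hT : ∫⁻ x, ‖u x‖ₑ ^ 2 ≠ ⊤ := lintegral_enorm_sq_ne_top hu.1
  exact ne_top_of_le_ne_top (ENNReal.mul_ne_top (ENNReal.mul_ne_top ENNReal.ofReal_ne_top
    (ENNReal.add_ne_top.2 ⟨hT, hu.gradSq_ne_top⟩)) hT) (hartree_le hγ hγN hγ2 hu)

/-! ### Infima of families of affine functions -/

section AffineInf

variable {ι : Type*} {A D : ι → ℝ}

theorem concaveOn_iInf_affine [Nonempty ι]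
    (hb : ∀ c : ℝ, 0 < c → BddBelow (Set.range fun i => A i / 2 + c / 4 * D i)) :
    ConcaveOn ℝ (Set.Ioi 0) fun c : ℝ => ⨅ i, (A i / 2 + c / 4 * D i) := by
  refine ⟨convex_Ioi 0, fun x hx y hy a b ha hb' hab => le_ciInf fun i => ?_⟩
  have h1 := mul_le_mul_of_nonneg_left (ciInf_le (hb x hx) i) ha
  have h2 := mul_le_mul_of_nonneg_left (ciInf_le (hb y hy) i) hb'
  simp only [smul_eq_mul]
  refine (add_le_add h1 h2).trans (le_of_eq ?_)
  linear_combination (A i / 2) * hab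

theorem iInf_affine_nonpos
    (hb : ∀ c : ℝ, 0 < c → BddBelow (Set.range fun i => A i / 2 + c / 4 * D i))
    (h0 : ∀ c : ℝ, 0 < c → ∀ ε : ℝ, 0 < ε → ∃ i, A i / 2 + c / 4 * D i < ε) {c : ℝ} (hc : 0 < c) :
    ⨅ i, (A i / 2 + c / 4 * D i) ≤ 0 := by
  refine le_of_forall_pos_lt_add fun ε hε => ?_
  obtain ⟨i, hi⟩ := h0 c hc ε hε
  rw [zero_add]
  exact (ciInf_le (hb c hc) i).trans_lt hi

/-- Members with `D i ≤ 0` decrease in `c`; those with `D i ≥ 0` are nonnegative, hence above the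
infimum at `d`, which is at most `0`. -/
theorem antitoneOn_iInf_affine [Nonempty ι] (hA : ∀ i, 0 ≤ A i)
    (hb : ∀ c : ℝ, 0 < c → BddBelow (Set.range fun i => A i / 2 + c / 4 * D i))
    (h0 : ∀ c : ℝ, 0 < c → ∀ ε : ℝ, 0 < ε → ∃ i, A i / 2 + c / 4 * D i < ε) :
    AntitoneOn (fun c : ℝ => ⨅ i, (A i / 2 + c / 4 * D i)) (Set.Ioi 0) := by
  intro c hc d hd hcd
  refine le_ciInf fun i => ?_
  rcases le_total (D i) 0 with h | h
  · refine (ciInf_le (hb d hd) i).trans ?_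
    have := mul_le_mul_of_nonpos_right hcd h
    linarith
  · refine (iInf_affine_nonpos hb h0 hd).trans ?_
    have := mul_nonneg (le_of_lt hc) h
    linarith [hA i]

/-- For `0 < c < 1` the infimum lies between its value at `1` and `0`, which squeezes the product.
-/
theorem tendsto_mul_iInf_affine_zero [Nonempty ι] (hA : ∀ i, 0 ≤ A i)
    (hb : ∀ c : ℝ, 0 < c → BddBelow (Set.range fun i => A i / 2 + c / 4 * D i))
    (h0 : ∀ c : ℝ, 0 < c → ∀ ε : ℝ, 0 < ε → ∃ i, A i / 2 + c / 4 * D i < ε) :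
    Tendsto (fun c : ℝ => c * ⨅ i, (A i / 2 + c / 4 * D i)) (𝓝[>] 0) (𝓝 0) := by
  have hl : Tendsto (fun c : ℝ => c * ⨅ i, (A i / 2 + 1 / 4 * D i)) (𝓝[>] 0) (𝓝 0) := by
    have : Tendsto (fun c : ℝ => c * ⨅ i, (A i / 2 + 1 / 4 * D i)) (𝓝 0) (𝓝 (0 * _)) :=
      tendsto_id.mul_const _
    rw [zero_mul] at this
    exact this.mono_left nhdsWithin_le_nhds
  refine tendsto_of_tendsto_of_tendsto_of_le_of_le' hl tendsto_const_nhds ?_ ?_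
  · filter_upwards [self_mem_nhdsWithin, mem_nhdsWithin_of_mem_nhds (Iio_mem_nhds one_pos)]
      with c hc hc1
    exact mul_le_mul_of_nonneg_left
      (antitoneOn_iInf_affine hA hb h0 hc (Set.mem_Ioi.2 one_pos) (le_of_lt hc1)) (le_of_lt hc)
  · filter_upwards [self_mem_nhdsWithin] with c hc
    exact mul_nonpos_of_nonneg_of_nonpos (le_of_lt hc) (iInf_affine_nonpos hb h0 hc)

/-- A single member with negative slope already bounds the product by a quadratic tending to `-∞`.
-/
theorem tendsto_mul_iInf_affine_atBot
    (hb : ∀ c : ℝ, 0 < c → BddBelow (Set.range fun i => A i / 2 + c / 4 * D i))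
    (hneg : ∃ i, D i < 0) :
    Tendsto (fun c : ℝ => c * ⨅ i, (A i / 2 + c / 4 * D i)) atTop atBot := by
  obtain ⟨i, hi⟩ := hneg
  have h1 : Tendsto (fun c : ℝ => A i / 2 + c / 4 * D i) atTop atBot := by
    refine tendsto_atBot_add_const_left _ _ ?_
    exact (tendsto_id.atTop_div_const (by norm_num)).atTop_mul_const_of_neg hi
  refine tendsto_atBot_mono' _ ?_ (tendsto_id.atTop_mul_atBot₀ h1)
  filter_upwards [eventually_gt_atTop 0] with c hc
  exact mul_le_mul_of_nonneg_left (ciInf_le (hb c hc) i) hc.le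

end AffineInf

/-! ### The energy in terms of real numbers -/

theorem energy_eq {N : ℕ} {γ₁ γ₂ : ℝ} {u : Space N → ℂ} (hg : gradSq u ≠ ⊤)
    (h₁ : hartree γ₁ u ≠ ⊤) (h₂ : hartree γ₂ u ≠ ⊤) :
    energy γ₁ γ₂ u = (((gradSq u).toReal / 2 +
      ((hartree γ₂ u).toReal - (hartree γ₁ u).toReal) / 4 : ℝ) : EReal) := by
  have hg' : gradSq u / 2 ≠ ⊤ := ENNReal.div_ne_top hg (by norm_num)
  have h₁' : hartree γ₁ u / 4 ≠ ⊤ := ENNReal.div_ne_top h₁ (by norm_num)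
  have h₂' : hartree γ₂ u / 4 ≠ ⊤ := ENNReal.div_ne_top h₂ (by norm_num)
  rw [energy, ← EReal.coe_toReal (x := ((hartree γ₁ u / 4 : ℝ≥0∞) : EReal)) (by simpa using h₁')
      (by simp), ← EReal.coe_toReal (x := ((gradSq u / 2 + hartree γ₂ u / 4 : ℝ≥0∞) : EReal))
      (by rw [ne_eq, EReal.coe_ennreal_eq_top_iff]; exact ENNReal.add_ne_top.2 ⟨hg', h₂'⟩)
      (by simp), ← EReal.coe_sub, EReal.toReal_coe_ennreal,
    EReal.toReal_coe_ennreal, ENNReal.toReal_add hg' h₂']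
  simp only [ENNReal.toReal_div, ENNReal.toReal_ofNat]
  congr 1; ring

theorem toReal_gradSq_dilate {N : ℕ} {u : Space N → ℂ} (hu : MemH1 u) (a : ℝ) {l : ℝ}
    (hl : 0 < l) :
    (gradSq (dilate a l u)).toReal = a ^ 2 * l ^ (2 - N : ℝ) * (gradSq u).toReal := by
  rw [gradSq_dilate hu a hl, ENNReal.toReal_mul, ENNReal.toReal_ofReal (by positivity)]

theorem toReal_hartree_dilate {N : ℕ} (γ : ℝ) (u : Space N → ℂ) (a : ℝ) {l : ℝ} (hl : 0 < l) :
    (hartree γ (dilate a l u)).toReal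
      = a ^ 4 * l ^ (γ - 2 * N) * (hartree γ u).toReal := by
  rw [hartree_dilate γ u a hl, ENNReal.toReal_mul, ENNReal.toReal_ofReal (by positivity)]

theorem integral_norm_sq_dilate {N : ℕ} {u : Space N → ℂ} (hu : MemLp u 2 volume) (a : ℝ) {l : ℝ}
    (hl : 0 < l) :
    ∫ x, ‖dilate a l u x‖ ^ 2 = a ^ 2 * l ^ (-N : ℝ) * ∫ x, ‖u x‖ ^ 2 := by
  have h := lintegral_enorm_sq_dilate u a hl
  rw [← ofReal_integral_norm_sq (memLp_dilate hu a hl), ← ofReal_integral_norm_sq hu,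
    ← ENNReal.ofReal_mul (by positivity)] at h
  refine (ENNReal.ofReal_eq_ofReal_iff (integral_nonneg fun x => sq_nonneg _) ?_).1 h
  have : 0 ≤ ∫ x, ‖u x‖ ^ 2 := integral_nonneg fun x => sq_nonneg _
  positivity

/-- Changing the amplitude maps mass spheres to mass spheres. -/
theorem dilate_one_mem_massSphere {N : ℕ} {c : ℝ} {u : Space N → ℂ} (hu : u ∈ massSphere N c)
    (a : ℝ) : dilate a 1 u ∈ massSphere N (a ^ 2 * c) := by
  refine ⟨hu.1.dilate a one_pos, ?_⟩
  rw [integral_norm_sq_dilate hu.1.1 a one_pos, hu.2, Real.one_rpow, mul_one]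

/-- Mass-preserving dilations. -/
theorem dilate_mem_massSphere {N : ℕ} {c : ℝ} {u : Space N → ℂ} (hu : u ∈ massSphere N c)
    {l : ℝ} (hl : 0 < l) : dilate (l ^ (N / 2 : ℝ)) l u ∈ massSphere N c := by
  refine ⟨hu.1.dilate _ hl, ?_⟩
  rw [integral_norm_sq_dilate hu.1.1 _ hl, hu.2, ← Real.rpow_natCast, ← Real.rpow_mul hl.le,
    ← Real.rpow_add hl]
  have : (N / 2 : ℝ) * (2 : ℕ) + -N = 0 := by push_cast; ring
  rw [this, Real.rpow_zero, one_mul]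

theorem toReal_gradSq_dilate_mass {N : ℕ} {u : Space N → ℂ} (hu : MemH1 u) {l : ℝ}
    (hl : 0 < l) :
    (gradSq (dilate (l ^ (N / 2 : ℝ)) l u)).toReal = l ^ 2 * (gradSq u).toReal := by
  rw [toReal_gradSq_dilate hu _ hl, ← Real.rpow_natCast, ← Real.rpow_mul hl.le,
    ← Real.rpow_add hl]
  have : (N / 2 : ℝ) * (2 : ℕ) + (2 - N) = (2 : ℕ) := by push_cast; ring
  rw [this, Real.rpow_natCast]

theorem toReal_hartree_dilate_mass {N : ℕ} (γ : ℝ) (u : Space N → ℂ) {l : ℝ} (hl : 0 < l) :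
    (hartree γ (dilate (l ^ (N / 2 : ℝ)) l u)).toReal = l ^ γ * (hartree γ u).toReal := by
  rw [toReal_hartree_dilate γ u _ hl, ← Real.rpow_natCast, ← Real.rpow_mul hl.le,
    ← Real.rpow_add hl]
  have : (N / 2 : ℝ) * (4 : ℕ) + (γ - 2 * N) = γ := by push_cast; ring
  rw [this]

/-- `hartree_le` is applied to the mass-preserving dilate of `u` and divided by `l ^ γ`. The free
parameter `l` plays the role of an interpolation inequality. -/
theorem toReal_hartree_le {N : ℕ} {γ : ℝ} (hγ : 0 < γ) (hγN : γ < N) (hγ2 : γ < 2) :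
    ∃ C : ℝ, 0 ≤ C ∧ ∀ u ∈ massSphere N 1, ∀ l : ℝ, 0 < l →
      (hartree γ u).toReal ≤ C * (l ^ (-γ) + l ^ (2 - γ) * (gradSq u).toReal) := by
  have hκ : 0 < N - γ := sub_pos.2 hγN
  refine ⟨2 * (4 / (N - γ) + 4 / (N - γ) ^ 2) + 1, by positivity, fun u hu l hl => ?_⟩
  set C := 2 * (4 / (N - γ) + 4 / (N - γ) ^ 2) + 1 with hC
  have hC0 : 0 ≤ C := by positivity
  have key : ∀ v ∈ massSphere N 1, (hartree γ v).toReal ≤ C * (1 + (gradSq v).toReal) := by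
    intro v hv
    have h := hartree_le hγ hγN hγ2 hv.1
    rw [← ofReal_integral_norm_sq hv.1.1, hv.2, ENNReal.ofReal_one, mul_one] at h
    have h' := ENNReal.toReal_mono (ENNReal.mul_ne_top ENNReal.ofReal_ne_top
      (ENNReal.add_ne_top.2 ⟨by simp, hv.1.gradSq_ne_top⟩)) h
    rwa [ENNReal.toReal_mul, ENNReal.toReal_ofReal hC0,
      ENNReal.toReal_add (by simp) hv.1.gradSq_ne_top, ENNReal.toReal_one] at h'
  have h := key _ (dilate_mem_massSphere hu hl)
  rw [toReal_hartree_dilate_mass γ u hl, toReal_gradSq_dilate_mass hu.1 hl] at h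
  have hp : 0 < l ^ γ := Real.rpow_pos_of_pos hl γ
  rw [sub_eq_add_neg, Real.rpow_add hl, Real.rpow_two, Real.rpow_neg hl.le]
  calc (hartree γ u).toReal = (l ^ γ)⁻¹ * (l ^ γ * (hartree γ u).toReal) := by field_simp
    _ ≤ (l ^ γ)⁻¹ * (C * (1 + l ^ 2 * (gradSq u).toReal)) := by gcongr
    _ = _ := by ring

/-! ### A test function -/

theorem isWeakPartial_of_contDiff {N : ℕ} (i : Fin N) {u : Space N → ℂ} (hu : ContDiff ℝ 1 u) :
    IsWeakPartial i u fun x => fderiv ℝ u x (EuclideanSpace.single i 1) := by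
  have hd : Continuous fun x => fderiv ℝ u x (EuclideanSpace.single i 1) :=
    (hu.continuous_fderiv (by simp)).clm_apply continuous_const
  refine ⟨hu.continuous.locallyIntegrable, hd.locallyIntegrable, fun φ hφ hs => ?_⟩
  have hφd : Continuous fun x => fderiv ℝ φ x (EuclideanSpace.single i 1) :=
    (hφ.continuous_fderiv (by simp)).clm_apply continuous_const
  have h := integral_smul_fderiv_eq_neg_fderiv_smul_of_integrable (μ := volume) (f := φ) (g := u)
    (v := EuclideanSpace.single i (1 : ℝ))
    ((hφd.smul hu.continuous).integrable_of_hasCompactSupport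
      ((hs.fderiv_apply ℝ _).smul_right))
    ((hφ.continuous.smul hd).integrable_of_hasCompactSupport hs.smul_right)
    ((hφ.continuous.smul hu.continuous).integrable_of_hasCompactSupport hs.smul_right)
    (fun x _ => (hφ.differentiable (by simp)) x) (fun x _ => (hu.differentiable (by simp)) x)
  rw [h, neg_neg]

theorem memH1_of_contDiff {N : ℕ} {u : Space N → ℂ} (hu : ContDiff ℝ 1 u)
    (hs : HasCompactSupport u) : MemH1 u := by
  refine ⟨hu.continuous.memLp_of_hasCompactSupport hs, fun i =>
    ⟨_, Continuous.memLp_of_hasCompactSupport ?_ ?_, isWeakPartial_of_contDiff i hu⟩⟩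
  · exact (hu.continuous_fderiv (by simp)).clm_apply continuous_const
  · exact hs.fderiv_apply ℝ _

theorem exists_massSphere_hartree_pos {N : ℕ} {γ : ℝ} (hγ : 0 < γ) :
    ∃ u ∈ massSphere N 1, hartree γ u ≠ 0 := by
  let φ : ContDiffBump (0 : Space N) := ⟨1, 2, one_pos, one_lt_two⟩
  let w : Space N → ℂ := fun x => (φ x : ℂ)
  have hw1 : ∀ x ∈ Metric.ball (0 : Space N) 1, w x = 1 := fun x hx => by
    have := φ.one_of_mem_closedBall (Metric.ball_subset_closedBall hx)
    simp only [w, this, Complex.ofReal_one]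
  have hwH : MemH1 w := by
    refine memH1_of_contDiff ?_ ?_
    · exact Complex.ofRealCLM.contDiff.comp φ.contDiff
    · exact φ.hasCompactSupport.comp_left (g := fun r : ℝ => (r : ℂ)) Complex.ofReal_zero
  set B := Metric.ball (0 : Space N) 1
  have hB : volume B ≠ 0 := (Metric.measure_ball_pos volume _ one_pos).ne'
  have hBm : MeasurableSet B := measurableSet_ball
  have hM : ∫⁻ x, ‖w x‖ₑ ^ 2 ≠ 0 := by
    refine fun h => hB (le_antisymm ?_ zero_le)
    rw [← h, ← one_mul (volume B), ← lintegral_indicator_const hBm]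
    refine lintegral_mono fun x => Set.indicator_apply_le' (fun hx => ?_) fun _ => zero_le
    simp [hw1 x hx]
  have hK : hartree γ w ≠ 0 := by
    -- Two points of the unit ball are at distance at most `2`, so the kernel is at least `2 ^ (-γ)`
    -- there.
    have h2 : ((2 : ℝ≥0∞) ^ γ)⁻¹ ≠ 0 := by simp
    have hpos : ((2 : ℝ≥0∞) ^ γ)⁻¹ * volume B * volume B ≠ 0 := mul_ne_zero (mul_ne_zero h2 hB) hB
    refine fun h => hpos (le_antisymm ?_ zero_le)
    rw [← h, ← lintegral_indicator_const hBm, ← lintegral_indicator_const hBm]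
    refine lintegral_mono fun x => Set.indicator_apply_le' (fun hx => ?_) fun _ => zero_le
    refine lintegral_mono fun y => Set.indicator_apply_le' (fun hy => ?_) fun _ => zero_le
    rw [hw1 x hx, hw1 y hy]
    simp only [enorm_one, one_pow, mul_one, one_div]
    gcongr
    have : ‖x - y‖ ≤ 2 := by
      have h1 : ‖x‖ < 1 := by simpa [B] using hx
      have h2 : ‖y‖ < 1 := by simpa [B] using hy
      linarith [norm_sub_le x y]
    rw [← ofReal_norm]
    exact ENNReal.ofReal_le_of_le_toReal (by simpa using this)
  set M := ∫ x, ‖w x‖ ^ 2 with hMdef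
  have hMpos : 0 < M := by
    rw [← ofReal_integral_norm_sq hwH.1] at hM
    simpa using hM
  have ha : (√M)⁻¹ ^ 2 * M = 1 := by
    rw [inv_pow, Real.sq_sqrt hMpos.le, inv_mul_cancel₀ hMpos.ne']
  refine ⟨dilate (√M)⁻¹ 1 w, ?_, ?_⟩
  · have := dilate_one_mem_massSphere (c := M) ⟨hwH, rfl⟩ (√M)⁻¹
    rwa [ha] at this
  · rw [hartree_dilate γ w _ one_pos]
    refine mul_ne_zero ?_ hK
    have : 0 < √M := Real.sqrt_pos.2 hMpos
    simp only [Real.one_rpow, mul_one, ne_eq, ENNReal.ofReal_eq_zero, not_le]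
    positivity

/-! ### The ground state energy -/

/-- The infimum over unit masses of the energy of `√c u`, divided by `c`. -/
def normalizedEnergy (N : ℕ) (γ₁ γ₂ c : ℝ) : ℝ :=
  ⨅ u : massSphere N 1, ((gradSq u.1).toReal / 2 +
    c / 4 * ((hartree γ₂ u.1).toReal - (hartree γ₁ u.1).toReal))

theorem bddBelow_normalizedEnergy {N : ℕ} {γ₁ γ₂ : ℝ} (hγ : 0 < γ₁) (hγN : γ₁ < N)
    (hγ2 : γ₁ < 2) (c : ℝ) (hc : 0 < c) :
    BddBelow (Set.range fun u : massSphere N 1 => (gradSq u.1).toReal / 2 +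
      c / 4 * ((hartree γ₂ u.1).toReal - (hartree γ₁ u.1).toReal)) := by
  obtain ⟨C, hC, hb⟩ := toReal_hartree_le hγ hγN hγ2
  have ht : Tendsto (fun l : ℝ => c / 4 * C * l ^ (2 - γ₁)) (𝓝[>] 0) (𝓝 0) := by
    have h := (Real.continuousAt_rpow_const 0 (2 - γ₁) (Or.inr (by linarith))).tendsto.const_mul
      (c / 4 * C)
    rw [Real.zero_rpow (by linarith), mul_zero] at h
    exact h.mono_left nhdsWithin_le_nhds
  -- Since `γ₁ < 2`, a small `l` brings the gradient coefficient below the `1/2` available from the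
  -- kinetic term; the `γ₂` term is nonnegative and dropped.
  obtain ⟨l, hl1, hl⟩ := ((ht.eventually (gt_mem_nhds (by norm_num : (0 : ℝ) < 1 / 2))).and
    self_mem_nhdsWithin).exists
  refine ⟨-(c / 4 * C * l ^ (-γ₁)), ?_⟩
  rintro _ ⟨u, rfl⟩
  have h1 := mul_le_mul_of_nonneg_left (hb u.1 u.2 l hl) (by positivity : 0 ≤ c / 4)
  have hA : 0 ≤ (gradSq u.1).toReal := ENNReal.toReal_nonneg
  have h2 := mul_le_mul_of_nonneg_right hl1.le hA
  have h3 : 0 ≤ c / 4 * (hartree γ₂ u.1).toReal := by positivity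
  simp only
  nlinarith

/-- Spreading a fixed profile out, `l → 0`, kills all three terms. -/
theorem exists_energy_lt {N : ℕ} {γ₁ γ₂ : ℝ} (hγ₂ : 0 < γ₂) (hγ₁ : 0 < γ₁) (c : ℝ)
    (ε : ℝ) (hε : 0 < ε) :
    ∃ u : massSphere N 1, (gradSq u.1).toReal / 2 +
      c / 4 * ((hartree γ₂ u.1).toReal - (hartree γ₁ u.1).toReal) < ε := by
  obtain ⟨u, hu, -⟩ := exists_massSphere_hartree_pos (N := N) hγ₁
  have hp : ∀ {q : ℝ}, 0 < q → Tendsto (fun l : ℝ => l ^ q) (𝓝[>] 0) (𝓝 0) := fun {q} hq => by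
    have h := (Real.continuousAt_rpow_const 0 q (Or.inr hq.le)).tendsto
    rw [Real.zero_rpow hq.ne'] at h
    exact h.mono_left nhdsWithin_le_nhds
  have ht : Tendsto (fun l : ℝ => l ^ (2 : ℝ) * (gradSq u).toReal / 2 +
      c / 4 * (l ^ γ₂ * (hartree γ₂ u).toReal - l ^ γ₁ * (hartree γ₁ u).toReal))
      (𝓝[>] 0) (𝓝 0) := by
    have := (((hp (zero_lt_two)).mul_const (gradSq u).toReal).div_const 2).add
      ((((hp hγ₂).mul_const (hartree γ₂ u).toReal).sub
        ((hp hγ₁).mul_const (hartree γ₁ u).toReal)).const_mul (c / 4))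
    simpa using this
  obtain ⟨l, hl1, hl⟩ := ((ht.eventually (gt_mem_nhds hε)).and self_mem_nhdsWithin).exists
  refine ⟨⟨_, dilate_mem_massSphere hu hl⟩, ?_⟩
  rw [toReal_gradSq_dilate_mass hu.1 hl, toReal_hartree_dilate_mass γ₂ u hl,
    toReal_hartree_dilate_mass γ₁ u hl]
  rwa [Real.rpow_two] at hl1

/-- Concentrating a profile, `l → ∞`, makes `l ^ γ₁` dominate `l ^ γ₂`. -/
theorem exists_hartree_sub_neg {N : ℕ} {γ₁ γ₂ : ℝ} (hγ₂ : 0 < γ₂) (hγ : γ₂ < γ₁)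
    (hγN : γ₁ < N) (hγ2 : γ₁ < 2) :
    ∃ u : massSphere N 1, (hartree γ₂ u.1).toReal - (hartree γ₁ u.1).toReal < 0 := by
  obtain ⟨u, hu, hpos⟩ := exists_massSphere_hartree_pos (N := N) (hγ₂.trans hγ)
  have hB : 0 < (hartree γ₁ u).toReal :=
    ENNReal.toReal_pos hpos (hartree_ne_top (hγ₂.trans hγ) hγN hγ2 hu.1)
  have ht : Tendsto (fun l : ℝ => l ^ (γ₁ - γ₂) * (hartree γ₁ u).toReal) atTop atTop :=
    (tendsto_rpow_atTop (sub_pos.2 hγ)).atTop_mul_const hB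
  obtain ⟨l, hl1, hl⟩ := ((ht.eventually_gt_atTop (hartree γ₂ u).toReal).and
    (eventually_gt_atTop 0)).exists
  refine ⟨⟨_, dilate_mem_massSphere hu hl⟩, ?_⟩
  rw [toReal_hartree_dilate_mass γ₂ u hl, toReal_hartree_dilate_mass γ₁ u hl]
  have e : l ^ γ₁ = l ^ γ₂ * l ^ (γ₁ - γ₂) := by rw [← Real.rpow_add hl]; congr 1; ring
  have hp : 0 < l ^ γ₂ := Real.rpow_pos_of_pos hl γ₂
  rw [e, mul_assoc, ← mul_sub]
  exact mul_neg_of_pos_of_neg hp (sub_neg.2 hl1)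

theorem nonempty_massSphere_one {N : ℕ} : Nonempty (massSphere N 1) := by
  obtain ⟨u, hu, -⟩ := exists_massSphere_hartree_pos (N := N) one_pos
  exact ⟨⟨u, hu⟩⟩

theorem groundEnergy_eq {N : ℕ} {γ₁ γ₂ : ℝ} (hγ₂ : 0 < γ₂) (hγ : γ₂ < γ₁) (hγN : γ₁ < N)
    (hγ2 : γ₁ < 2) {c : ℝ} (hc : 0 < c) :
    groundEnergy N γ₁ γ₂ c = ((c * normalizedEnergy N γ₁ γ₂ c : ℝ) : EReal) := by
  have := nonempty_massSphere_one (N := N)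
  have hbdd := bddBelow_normalizedEnergy (γ₂ := γ₂) (hγ₂.trans hγ) hγN hγ2 c hc
  have hE : ∀ {u : Space N → ℂ}, MemH1 u → energy γ₁ γ₂ u = (((gradSq u).toReal / 2 +
      ((hartree γ₂ u).toReal - (hartree γ₁ u).toReal) / 4 : ℝ) : EReal) := fun hu =>
    energy_eq hu.gradSq_ne_top (hartree_ne_top (hγ₂.trans hγ) hγN hγ2 hu)
      (hartree_ne_top hγ₂ (hγ.trans hγN) (hγ.trans hγ2) hu)
  have hsq : √c ^ 2 = c := Real.sq_sqrt hc.le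
  have hsq4 : √c ^ 4 = c ^ 2 := by rw [show 4 = 2 * 2 from rfl, pow_mul, hsq]
  apply le_antisymm
  -- No minimizer is available, so an almost optimal unit-mass function is scaled up to mass `c`.
  · refine le_of_forall_gt fun b hb => ?_
    obtain ⟨r, hr, hrb⟩ := EReal.lt_iff_exists_real_btwn.1 hb
    rw [EReal.coe_lt_coe_iff, mul_comm, ← lt_div_iff₀ hc] at hr
    obtain ⟨u, hu⟩ := exists_lt_of_ciInf_lt hr
    refine lt_of_le_of_lt ?_ hrb
    have hmem := dilate_one_mem_massSphere u.2 (√c)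
    rw [hsq, mul_one] at hmem
    refine (iInf₂_le _ hmem).trans ?_
    rw [hE hmem.1, EReal.coe_le_coe_iff, toReal_gradSq_dilate u.2.1 _ one_pos,
      toReal_hartree_dilate _ _ _ one_pos, toReal_hartree_dilate _ _ _ one_pos, hsq, hsq4]
    simp only [Real.one_rpow, mul_one]
    rw [lt_div_iff₀ hc] at hu
    linarith
  · refine le_iInf₂ fun u hu => ?_
    have hmem := dilate_one_mem_massSphere hu (√c)⁻¹
    rw [inv_pow, hsq, inv_mul_cancel₀ hc.ne'] at hmem
    have h := mul_le_mul_of_nonneg_left (ciInf_le hbdd ⟨_, hmem⟩) hc.le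
    rw [toReal_gradSq_dilate hu.1 _ one_pos, toReal_hartree_dilate _ _ _ one_pos,
      toReal_hartree_dilate _ _ _ one_pos, inv_pow, inv_pow, hsq, hsq4] at h
    rw [hE hu.1, EReal.coe_le_coe_iff]
    refine h.trans (le_of_eq ?_)
    simp only [Real.one_rpow, mul_one]
    field_simp

/-- At zero mass the bound `hartree_le` has a factor `0`, so the only negative term of the energy
vanishes; amplitude `0` attains the value. -/
theorem groundEnergy_zero {N : ℕ} {γ₁ γ₂ : ℝ} (hγ₁ : 0 < γ₁) (hγN : γ₁ < N)
    (hγ2 : γ₁ < 2) : groundEnergy N γ₁ γ₂ 0 = 0 := by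
  apply le_antisymm
  · obtain ⟨u, hu⟩ := nonempty_massSphere_one (N := N)
    have hmem := dilate_one_mem_massSphere hu 0
    rw [zero_pow two_ne_zero, zero_mul] at hmem
    refine (iInf₂_le _ hmem).trans ?_
    rw [energy, gradSq_dilate hu.1 _ one_pos, hartree_dilate _ _ _ one_pos,
      hartree_dilate _ _ _ one_pos]
    simp
  · refine le_iInf₂ fun u hu => ?_
    have h := hartree_le hγ₁ hγN hγ2 hu.1
    rw [← ofReal_integral_norm_sq hu.1.1, hu.2, ENNReal.ofReal_zero, mul_zero] at h
    rw [energy, le_antisymm h zero_le]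
    simpa using add_nonneg (EReal.coe_ennreal_nonneg _) (EReal.coe_ennreal_nonneg _)

end Hartree

end

/-! ### Deduction of the theorem from the normalized energy -/

theorem proposition1p1 (N : ℕ) (γ₁ γ₂ : ℝ) (hγ₂ : 0 < γ₂) (hγ : γ₂ < γ₁)
    (hγ₁ : γ₁ < min (N : ℝ) 2) :
    (∀ c : ℝ, 0 ≤ c →
      ⊥ < Hartree.groundEnergy N γ₁ γ₂ c ∧ Hartree.groundEnergy N γ₁ γ₂ c ≤ 0) ∧
    ContinuousOn (fun c : ℝ => Hartree.groundEnergy N γ₁ γ₂ c) (Set.Ioi 0) ∧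
    (∀ c₁ c₂ : ℝ, 0 ≤ c₁ → 0 ≤ c₂ → 0 < c₁ + c₂ →
      Hartree.groundEnergy N γ₁ γ₂ (c₁ + c₂) ≤
        Hartree.groundEnergy N γ₁ γ₂ c₁ + Hartree.groundEnergy N γ₁ γ₂ c₂) ∧
    AntitoneOn (fun c : ℝ => Hartree.groundEnergy N γ₁ γ₂ c) (Set.Ioi 0) ∧
    Tendsto (fun c : ℝ => Hartree.groundEnergy N γ₁ γ₂ c) (𝓝[>] 0) (𝓝 0) ∧
    Tendsto (fun c : ℝ => Hartree.groundEnergy N γ₁ γ₂ c) atTop (𝓝 ⊥) := by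
  have hγN : γ₁ < N := hγ₁.trans_le (min_le_left _ _)
  have hγ2 : γ₁ < 2 := hγ₁.trans_le (min_le_right _ _)
  have hpos : 0 < γ₁ := hγ₂.trans hγ
  have := Hartree.nonempty_massSphere_one (N := N)
  set f := Hartree.normalizedEnergy N γ₁ γ₂
  have hm : ∀ c : ℝ, 0 < c → Hartree.groundEnergy N γ₁ γ₂ c = ((c * f c : ℝ) : EReal) :=
    fun c hc => Hartree.groundEnergy_eq hγ₂ hγ hγN hγ2 hc
  have hm0 : Hartree.groundEnergy N γ₁ γ₂ 0 = 0 := Hartree.groundEnergy_zero hpos hγN hγ2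
  have hb := Hartree.bddBelow_normalizedEnergy (γ₂ := γ₂) hpos hγN hγ2
  have h0 := fun (c : ℝ) (_ : 0 < c) => Hartree.exists_energy_lt (N := N) hγ₂ hpos c
  have hA := fun u : Hartree.massSphere N 1 => ENNReal.toReal_nonneg (a := Hartree.gradSq u.1)
  have hf0 : ∀ c : ℝ, 0 < c → f c ≤ 0 := fun c hc => Hartree.iInf_affine_nonpos hb h0 hc
  have hanti : AntitoneOn f (Set.Ioi 0) := Hartree.antitoneOn_iInf_affine hA hb h0
  have hcont : ContinuousOn f (Set.Ioi 0) :=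
    (Hartree.concaveOn_iInf_affine hb).continuousOn isOpen_Ioi
  refine ⟨fun c hc => ?_, ?_, fun c₁ c₂ h₁ h₂ _ => ?_, fun c hc d hd hcd => ?_, ?_, ?_⟩
  · rcases hc.eq_or_lt with rfl | hc
    · rw [hm0]
      exact ⟨EReal.bot_lt_zero, le_rfl⟩
    · rw [hm c hc]
      exact ⟨EReal.bot_lt_coe _, by
        exact_mod_cast mul_nonpos_of_nonneg_of_nonpos hc.le (hf0 c hc)⟩
  · refine (continuous_coe_real_ereal.comp_continuousOn (continuousOn_id.mul hcont)).congr
      fun c hc => hm c hc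
  · rcases h₁.eq_or_lt with rfl | h₁
    · rw [hm0, zero_add, zero_add]
    rcases h₂.eq_or_lt with rfl | h₂
    · rw [hm0, add_zero, add_zero]
    rw [hm _ h₁, hm _ h₂, hm _ (add_pos h₁ h₂), ← EReal.coe_add, EReal.coe_le_coe_iff, add_mul]
    -- Subadditivity is `cᵢ f(c₁ + c₂) ≤ cᵢ f(cᵢ)`, summed over the two masses.
    exact add_le_add
      (mul_le_mul_of_nonneg_left (hanti h₁ (add_pos h₁ h₂ : _ < _) (by linarith)) h₁.le)
      (mul_le_mul_of_nonneg_left (hanti h₂ (add_pos h₁ h₂ : _ < _) (by linarith)) h₂.le)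
  · simp only
    rw [hm c hc, hm d hd, EReal.coe_le_coe_iff]
    -- `d f(d) ≤ d f(c) ≤ c f(c)`, the last step because `f(c) ≤ 0`.
    exact (mul_le_mul_of_nonneg_left (hanti hc hd hcd) (le_of_lt hd)).trans
      (mul_le_mul_of_nonpos_right hcd (hf0 c hc))
  · have h : Tendsto (fun c => ((c * f c : ℝ) : EReal)) (𝓝[>] 0) (𝓝 ((0 : ℝ) : EReal)) :=
      EReal.tendsto_coe.2 (Hartree.tendsto_mul_iInf_affine_zero hA hb h0)
    refine h.congr' ?_
    filter_upwards [self_mem_nhdsWithin] with c hc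
    rw [hm c hc]
  · have h : Tendsto (fun c => ((c * f c : ℝ) : EReal)) atTop (𝓝 ⊥) :=
      EReal.tendsto_coe_nhds_bot_iff.2 (Hartree.tendsto_mul_iInf_affine_atBot hb
        (Hartree.exists_hartree_sub_neg hγ₂ hγ hγN hγ2))
    refine h.congr' ?_
    filter_upwards [eventually_gt_atTop 0] with c hc
    rw [hm c hc]
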